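/- Let $q\ge 2$ and let $\mathcal X$ be (the vertex set of) a homogeneous tree of degree $q+1$, i.e. a connected graph without cycles in which every vertex has exactly $q+1$ neighbours, with graph distance $d$, a fixed base vertex $o$, $|x|=d(o,x)$, $B(o,n)=\{x:|x|\le n\}$, and the counting measure. Let $\Omega$ be the set of infinite geodesic rays $\omega=\{\omega_0,\omega_1,\dots\}$ starting at $o$. For $x\in\mathcal X$ and $\omega\in\Omega$ let $c(x,\omega)$ be the last point of the geodesic path from $o$ to $x$ that lies on $\omega$, and let $E(x)=\{\omega:|c(x,\omega)|\ge |x|\}$. Let $\nu$ be the unique probability measure on the $\sigma$-algebra generated by the sets $E(x)$ with $\nu(E(o))=1$ and $\nu(E(x))=\frac{1}{(q+1)q^{|x|-1}}$ for $x\ne o$, and put $L^2(\Omega)=L^2(\Omega,\nu)$ (complex-valued). Define $p(x,\omega)=q^{2|c(x,\omega)|-|x|}$, and for $z\in\mathbb C$ $$\mathcal P_zF(x)=\int_\Omega p^{1/2+iz}(x,\omega)F(\omega)\,d\nu(\omega),\qquad \mathcal Lu(x)=u(x)-\frac1{q+1}\sum_{d(x,y)=1}u(y),$$ $$\gamma(z)=1-\frac{q^{1/2+iz}+q^{1/2-iz}}{q+1},\qquad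 \tau=\frac{2\pi}{\log q},\qquad \mathbf c(z)=\frac{q^{1/2}}{q+1}\,\frac{q^{1/2+iz}-q^{-1/2-iz}}{q^{iz}-q^{-iz}}\quad (z\notin(\tau/2)\mathbb Z).$$ Let $L^{2,\infty}(\mathcal X)$ be the space of functions $u:\mathcal X\to\mathbb C$ with $\sup_{t>0}t\,\big(\#\{x\in\mathcal X:|u(x)|>t\}\big)^{1/2}<\infty$. Let $z\in\mathbb R\setminus(\tau/2)\mathbb Z$, and let $u\in L^{2,\infty}(\mathcal X)$ satisfy $\mathcal Lu=\gamma(z)u$ on $\mathcal X$. Then there exists $F\in L^2(\Omega)$ such that $u=\mathcal P_zF$ and $$\frac{q}{2(q+1)|\mathbf c(z)|^2}\,\lim_{n\to\infty}\left(\frac1n\sum_{x\in B(o,n)}p^{1/2-iz}(x,\omega)\,u(x)\right)=F(\omega)\quad\text{in } L^2(\Omega)\text{-norm}.$$ Moreover, $F$ is the only element of $L^2(\Omega)$ with $u=\mathcal P_zF$, and also the only element of $L^2(\Omega)$ that is the above limit. -/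

import Mathlib

open MeasureTheory Filter Topology
open scoped ENNReal NNReal

namespace HomTree

universe v

/-- A homogeneous tree of degree `q + 1`, where `q ≥ 2`: a connected graph without cycles in
which every vertex has exactly `q + 1` neighbours. -/
structure IsHomogeneousTree {V : Type v} (G : SimpleGraph V) [G.LocallyFinite] (q : ℕ) : Prop where
  isTree : G.IsTree
  regular : G.IsRegularOfDegree (q + 1)
  two_le : 2 ≤ q

/-- The vertices of the geodesic path joining `x` to `y`. -/
def segment {V : Type v} (G : SimpleGraph V) (x y : V) : Set V :=
  {w | G.dist x w + G.dist w y = G.dist x y}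

/-- The closed ball `B(o, n)`. -/
def ball {V : Type v} (G : SimpleGraph V) (o : V) (n : ℕ) : Set V :=
  {x | G.dist o x ≤ n}

/-- Closed balls are finite, so that sums over them are honest finite sums. -/
theorem ball_finite {V : Type v} {G : SimpleGraph V} [G.LocallyFinite] {q : ℕ}
    (h : IsHomogeneousTree G q) (o : V) (n : ℕ) : (ball G o n).Finite := by
  induction n with
  | zero =>
    refine (Set.finite_singleton o).subset fun x hx => ?_
    have h0 : G.dist o x = 0 := Nat.le_zero.mp hx
    exact ((h.isTree.connected.dist_eq_zero_iff).mp h0).symm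
  | succ n ih =>
    have hfin : (ball G o n ∪ ⋃ y ∈ ball G o n, (G.neighborFinset y : Set V)).Finite :=
      ih.union (ih.biUnion fun y _ => Finset.finite_toSet _)
    refine hfin.subset fun x hx => ?_
    by_cases hxn : G.dist o x ≤ n
    · exact Or.inl hxn
    · right
      have hx' : G.dist o x = n + 1 := by
        have : G.dist o x ≤ n + 1 := hx
        omega
      obtain ⟨p, hp⟩ := h.isTree.connected.exists_walk_length_eq_dist o x
      have hnil : ¬ p.Nil := by
        intro hn
        have := SimpleGraph.Walk.length_eq_zero_iff.mpr hn
        omega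
      have hadj := p.adj_penultimate hnil
      have hle : G.dist o p.penultimate ≤ n := by
        refine (SimpleGraph.dist_le p.dropLast).trans ?_
        simp
        omega
      simp only [Set.mem_iUnion]
      exact ⟨p.penultimate, hle, by simpa using hadj⟩

/-- The boundary `Ω`: infinite geodesic rays `ω₀, ω₁, ω₂, …` starting from `o`. -/
def Boundary {V : Type v} (G : SimpleGraph V) (o : V) : Type v :=
  {ω : ℕ → V // ω 0 = o ∧ ∀ m n, G.dist (ω m) (ω (m + n)) = n}

/-- The `n`-th vertex of a ray. -/
def Boundary.vertex {V : Type v} {G : SimpleGraph V} {o : V} (ω : Boundary G o) (n : ℕ) : V :=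
  ω.1 n

open Classical in
/-- `c(x, ω)`: the last point lying on the ray `ω` in the geodesic path from `o` to `x`. -/
noncomputable def confluence {V : Type v} (G : SimpleGraph V) (o x : V) (ω : Boundary G o) : V :=
  ω.vertex (Nat.findGreatest (fun j => ω.vertex j ∈ segment G o x) (G.dist o x))

/-- The sets `E_j(x) = {ω : |c(x, ω)| ≥ j}`. -/
def sectorAt {V : Type v} (G : SimpleGraph V) (o : V) (j : ℕ) (x : V) : Set (Boundary G o) :=
  {ω | j ≤ G.dist o (confluence G o x ω)}

/-- The sectors `E(x) = E_{|x|}(x)`. -/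
def sector {V : Type v} (G : SimpleGraph V) (o x : V) : Set (Boundary G o) :=
  sectorAt G o (G.dist o x) x

/-- The σ-algebra on `Ω` generated by the sectors `E(x)`. -/
instance {V : Type v} (G : SimpleGraph V) (o : V) : MeasurableSpace (Boundary G o) :=
  MeasurableSpace.generateFrom (Set.range (sector G o))

open Classical in
/-- The prescribed mass of the sector `E(x)`. -/
noncomputable def sectorMass {V : Type v} (G : SimpleGraph V) (o : V) (q : ℕ) (x : V) : ℝ≥0∞ :=
  if x = o then 1 else (((q + 1) * q ^ (G.dist o x - 1) : ℕ) : ℝ≥0∞)⁻¹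

section Auxiliary

variable {V : Type v} {G : SimpleGraph V} {o : V}

theorem Boundary.vertex_zero (ω : Boundary G o) : ω.vertex 0 = o := ω.2.1

theorem Boundary.dist_vertex (ω : Boundary G o) (n : ℕ) : G.dist o (ω.vertex n) = n := by
  have := ω.2.2 0 n
  rw [ω.2.1, Nat.zero_add] at this
  exact this

theorem Boundary.adj_vertex (ω : Boundary G o) (n : ℕ) :
    G.Adj (ω.vertex n) (ω.vertex (n + 1)) :=
  SimpleGraph.dist_eq_one_iff_adj.mp (ω.2.2 n 1)

theorem mem_sector_iff (hG : G.Connected) (x : V) (ω : Boundary G o) :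
    ω ∈ sector G o x ↔ ω.vertex (G.dist o x) = x := by
  classical
  simp only [sector, sectorAt, confluence, Set.mem_ofPred_eq, Boundary.dist_vertex]
  constructor
  · intro h
    by_cases h0 : G.dist o x = 0
    · rw [h0, ω.vertex_zero]
      exact hG.dist_eq_zero_iff.mp h0
    · have heq := le_antisymm (Nat.findGreatest_le (G.dist o x)) h
      have hP := Nat.findGreatest_of_ne_zero heq h0
      simp only [segment, Set.mem_ofPred_eq, Boundary.dist_vertex] at hP
      exact hG.dist_eq_zero_iff.mp (by omega)
  · intro h
    refine Nat.le_findGreatest le_rfl ?_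
    simp [segment, h]

/-- In a tree a vertex has at most one neighbour that is closer to `o`. -/
theorem parent_unique (hG : G.IsTree) {x y y' : V} (hy : G.Adj y x) (hy' : G.Adj y' x)
    (hd : G.dist o x = G.dist o y + 1) (hd' : G.dist o x = G.dist o y' + 1) : y = y' := by
  obtain ⟨p, hp⟩ := hG.connected.exists_walk_length_eq_dist o y
  obtain ⟨p', hp'⟩ := hG.connected.exists_walk_length_eq_dist o y'
  have h1 : (p.concat hy).IsPath :=
    (p.concat hy).isPath_of_length_eq_dist (by rw [SimpleGraph.Walk.length_concat]; omega)
  have h2 : (p'.concat hy').IsPath :=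
    (p'.concat hy').isPath_of_length_eq_dist (by rw [SimpleGraph.Walk.length_concat]; omega)
  have h3 : p.concat hy = p'.concat hy' := by
    have := (hG.isAcyclic.subsingleton_path o x).elim ⟨_, h1⟩ ⟨_, h2⟩
    exact congrArg Subtype.val this
  have := congrArg SimpleGraph.Walk.penultimate h3
  simpa using this

theorem exists_parent (hG : G.Connected) {x : V} (hx : x ≠ o) :
    ∃ y, G.Adj y x ∧ G.dist o x = G.dist o y + 1 := by
  obtain ⟨p, hp⟩ := hG.exists_walk_length_eq_dist o x
  have hpos := hG.pos_dist_of_ne (Ne.symm hx)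
  have hnil : ¬ p.Nil := by
    intro hn
    have := SimpleGraph.Walk.length_eq_zero_iff.mpr hn
    omega
  have hadj := p.adj_penultimate hnil
  refine ⟨p.penultimate, hadj, ?_⟩
  have h1 : G.dist o p.penultimate ≤ p.length - 1 := by
    refine (SimpleGraph.dist_le p.dropLast).trans ?_
    simp
  have h2 : G.dist o x ≤ G.dist o p.penultimate + 1 := by
    have := hG.dist_triangle (u := o) (v := p.penultimate) (w := x)
    rwa [SimpleGraph.dist_eq_one_iff_adj.mpr hadj] at this
  omega

theorem vertex_eq_of_le (hG : G.IsTree) (ω ω' : Boundary G o) {m n : ℕ} (hmn : m ≤ n)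
    (h : ω.vertex n = ω'.vertex n) : ω.vertex m = ω'.vertex m := by
  induction n, hmn using Nat.le_induction with
  | base => exact h
  | succ n _ ih =>
    refine ih (parent_unique (o := o) hG (ω.adj_vertex n) (h ▸ ω'.adj_vertex n) ?_ ?_) <;>
    simp [Boundary.dist_vertex]

variable [G.LocallyFinite]

open Classical in
/-- The neighbours of `v` that are further away from `o`. -/
noncomputable def children (G : SimpleGraph V) [G.LocallyFinite] (o v : V) : Finset V :=
  {w ∈ G.neighborFinset v | G.dist o w = G.dist o v + 1}

theorem mem_children {v w : V} :
    w ∈ children G o v ↔ G.Adj v w ∧ G.dist o w = G.dist o v + 1 := by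
  simp [children]

open Classical in
theorem card_children {q : ℕ} (h : IsHomogeneousTree G q) (v : V) :
    (children G o v).card = if v = o then q + 1 else q := by
  have hreg : (G.neighborFinset v).card = q + 1 := h.regular v
  split_ifs with hv
  · subst hv
    rw [← hreg]
    congr 1
    ext w
    rw [mem_children, SimpleGraph.mem_neighborFinset]
    refine ⟨fun hw => hw.1, fun hw => ⟨hw, ?_⟩⟩
    rw [SimpleGraph.dist_self, SimpleGraph.dist_eq_one_iff_adj.mpr hw]
  · obtain ⟨y, hy, hd⟩ := exists_parent h.isTree.connected hv
    have hE : children G o v = (G.neighborFinset v).erase y := by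
      ext w
      rw [mem_children, Finset.mem_erase, SimpleGraph.mem_neighborFinset]
      constructor
      · rintro ⟨hw, hwd⟩
        refine ⟨?_, hw⟩
        rintro rfl
        omega
      · rintro ⟨hne, hw⟩
        refine ⟨hw, ?_⟩
        rcases h.isTree.dist_eq_dist_add_one_of_adj o hw with h1 | h1
        · exact absurd (parent_unique (o := o) h.isTree hw.symm hy h1 hd) hne
        · exact h1
    rw [hE, Finset.card_erase_of_mem (by simpa using hy.symm), hreg]
    rfl

theorem children_nonempty {q : ℕ} (h : IsHomogeneousTree G q) (v : V) :
    Nonempty (children G o v) := by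
  classical
  have h2 := h.two_le
  have hc := card_children (o := o) h v
  have : 0 < (children G o v).card := by
    rw [hc]
    split_ifs <;> omega
  obtain ⟨w, hw⟩ := Finset.card_pos.mp this
  exact ⟨⟨w, hw⟩⟩

/-- The vertices obtained by starting at `o` and following chosen children. -/
def follow (ξ : ∀ v : V, children G o v) : ℕ → V
  | 0 => o
  | n + 1 => (ξ (follow ξ n) : V)

theorem follow_adj (ξ : ∀ v : V, children G o v) (n : ℕ) :
    G.Adj (follow ξ n) (follow ξ (n + 1)) :=
  (mem_children.mp (ξ (follow ξ n)).2).1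

theorem dist_follow (ξ : ∀ v : V, children G o v) (n : ℕ) : G.dist o (follow ξ n) = n := by
  induction n with
  | zero => simp [follow]
  | succ n ih =>
    have := (mem_children.mp (ξ (follow ξ n)).2).2
    rw [ih] at this
    exact this

/-- The ray obtained by following chosen children. -/
def followRay (hG : G.Connected) (ξ : ∀ v : V, children G o v) : Boundary G o :=
  ⟨follow ξ, rfl, fun m n => by
    refine le_antisymm ?_ ?_
    · induction n with
      | zero => simp
      | succ n ih =>
        have h1 := hG.dist_triangle (u := follow ξ m) (v := follow ξ (m + n))
          (w := follow ξ (m + n + 1))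
        rw [SimpleGraph.dist_eq_one_iff_adj.mpr (follow_adj ξ (m + n))] at h1
        rw [← Nat.add_assoc]
        omega
    · have h1 := hG.dist_triangle (u := o) (v := follow ξ m) (w := follow ξ (m + n))
      rw [dist_follow, dist_follow] at h1
      omega⟩

theorem follow_cylinder {q : ℕ} (h : IsHomogeneousTree G q) (n : ℕ) :
    ∀ x : V, G.dist o x = n → ∃ (s : Finset V) (c : ∀ v : V, children G o v),
      (∀ v ∈ s, G.dist o v < n) ∧
      {ξ : ∀ v : V, children G o v | follow ξ n = x} = Set.pi (s : Set V) (fun v => {c v}) ∧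
      ∏ v ∈ s, ((children G o v).card : ℝ≥0∞)⁻¹ = sectorMass G o q x := by
  classical
  have hne : ∀ v, Nonempty (children G o v) := children_nonempty h
  have hG := h.isTree.connected
  induction n with
  | zero =>
    intro x hx
    obtain rfl : o = x := hG.dist_eq_zero_iff.mp hx
    refine ⟨∅, fun v => (hne v).some, by simp, ?_, by simp [sectorMass]⟩
    ext ξ
    simp [follow]
  | succ n ih =>
    intro x hx
    have hxo : x ≠ o := by
      rintro rfl
      simp at hx
    obtain ⟨y, hy, hd⟩ := exists_parent hG hxo
    have hyn : G.dist o y = n := by omega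
    obtain ⟨s, c, hs, hset, hprod⟩ := ih y hyn
    have hxy : x ∈ children G o y := mem_children.mpr ⟨hy, hd⟩
    have hys : y ∉ s := fun hmem => by
      have := hs y hmem
      omega
    refine ⟨insert y s, Function.update c y ⟨x, hxy⟩, ?_, ?_, ?_⟩
    · intro v hv
      rcases Finset.mem_insert.mp hv with rfl | hv
      · omega
      · have := hs v hv
        omega
    · have hstep : {ξ : ∀ v : V, children G o v | follow ξ (n + 1) = x} =
          {ξ | follow ξ n = y} ∩ {ξ | ξ y = ⟨x, hxy⟩} := by
        ext ξ
        simp only [Set.mem_ofPred_eq, Set.mem_inter_iff]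
        constructor
        · intro hξ
          have h1 : follow ξ n = y := by
            refine parent_unique (o := o) h.isTree (hξ ▸ follow_adj ξ n) hy ?_ hd
            rw [dist_follow, hx]
          refine ⟨h1, Subtype.ext ?_⟩
          have h2 : (ξ (follow ξ n) : V) = x := hξ
          rw [h1] at h2
          exact h2
        · rintro ⟨h1, h2⟩
          change (ξ (follow ξ n) : V) = x
          rw [h1, h2]
      rw [hstep, hset]
      ext ξ
      simp only [Set.mem_inter_iff, Set.mem_pi, Set.mem_singleton_iff, Set.mem_ofPred_eq,
        Finset.coe_insert, Set.mem_insert_iff, forall_eq_or_imp, Finset.mem_coe,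
        Function.update_self]
      rw [and_comm]
      refine and_congr Iff.rfl (forall₂_congr fun v hv => ?_)
      rw [Function.update_of_ne (by rintro rfl; exact hys hv)]
    · rw [Finset.prod_insert hys, hprod, card_children h]
      by_cases hyo : y = o
      · subst hyo
        have : n = 0 := by simpa using hyn.symm
        subst this
        simp [sectorMass, hxo, hx]
      · have hn : n ≠ 0 := by
          intro hn
          exact hyo (hG.dist_eq_zero_iff.mp (hyn.trans hn)).symm
        obtain ⟨k, rfl⟩ := Nat.exists_eq_succ_of_ne_zero hn
        simp only [sectorMass, if_neg hxo, if_neg hyo, hx, hyn]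
        rw [← ENNReal.mul_inv (Or.inr (ENNReal.natCast_ne_top _)) (Or.inl (ENNReal.natCast_ne_top _))]
        congr 1
        rw [← Nat.cast_mul]
        congr 1
        simp only [Nat.succ_eq_add_one, Nat.add_sub_cancel]
        ring

end Auxiliary

/-- There is exactly one probability measure on `Ω` with `ν(E(o)) = 1` and
`ν(E(x)) = 1 / ((q + 1) q^{|x| - 1})` for `x ≠ o`. -/
theorem existsUnique_boundaryMeasure {V : Type v} {G : SimpleGraph V} [G.LocallyFinite] {q : ℕ}
    (h : IsHomogeneousTree G q) (o : V) :
    ∃! ν : Measure (Boundary G o),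
      IsProbabilityMeasure ν ∧ ∀ x, ν (sector G o x) = sectorMass G o q x := by
  classical
  have hG := h.isTree.connected
  have hne : ∀ v, Nonempty (children G o v) := children_nonempty h
  refine existsUnique_of_exists_of_unique ?_ ?_
  · let _ : ∀ v, MeasurableSpace (children G o v) := fun _ => ⊤
    have : ∀ v, DiscreteMeasurableSpace (children G o v) := fun _ => ⟨fun _ => trivial⟩
    let μ : ∀ v, Measure (children G o v) := fun v =>
      (PMF.uniformOfFintype (children G o v)).toMeasure
    have : ∀ v, IsProbabilityMeasure (μ v) := fun v => inferInstance
    have hμ : ∀ v (w : children G o v), μ v {w} = ((children G o v).card : ℝ≥0∞)⁻¹ := by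
      intro v w
      simp only [μ]
      rw [PMF.toMeasure_apply_singleton _ _ (MeasurableSet.singleton w)]
      simp
    have hpre : ∀ x, followRay hG ⁻¹' (sector G o x) =
        {ξ : ∀ v : V, children G o v | follow ξ (G.dist o x) = x} := by
      intro x
      ext ξ
      exact mem_sector_iff hG x _
    have hcyl : ∀ x, MeasurableSet (followRay hG ⁻¹' (sector G o x)) ∧
        Measure.infinitePi μ (followRay hG ⁻¹' (sector G o x)) = sectorMass G o q x := by
      intro x
      obtain ⟨s, c, -, hset, hprod⟩ := follow_cylinder h _ x rfl
      rw [hpre, hset]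
      refine ⟨MeasurableSet.pi s.countable_toSet fun v _ => MeasurableSet.singleton _, ?_⟩
      rw [Measure.infinitePi_pi _ fun v _ => MeasurableSet.singleton _, ← hprod]
      exact Finset.prod_congr rfl fun v _ => hμ v _
    have hmeas : Measurable (followRay (o := o) hG) := by
      refine measurable_generateFrom ?_
      rintro _ ⟨x, rfl⟩
      exact (hcyl x).1
    refine ⟨(Measure.infinitePi μ).map (followRay hG),
      Measure.isProbabilityMeasure_map hmeas.aemeasurable, fun x => ?_⟩
    rw [Measure.map_apply hmeas (MeasurableSpace.measurableSet_generateFrom ⟨x, rfl⟩)]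
    exact (hcyl x).2
  · rintro ν₁ ν₂ ⟨hp₁, h₁⟩ ⟨hp₂, h₂⟩
    refine ext_of_generate_finite (Set.range (sector G o)) rfl ?_ ?_ ?_
    · have key : ∀ x y, G.dist o x ≤ G.dist o y → (sector G o x ∩ sector G o y).Nonempty →
          sector G o x ∩ sector G o y = sector G o y := by
        rintro x y hxy ⟨ω, hωx, hωy⟩
        rw [mem_sector_iff hG] at hωx hωy
        refine Set.inter_eq_right.mpr fun ω' hω' => ?_
        rw [mem_sector_iff hG] at hω' ⊢
        rw [← vertex_eq_of_le h.isTree ω ω' hxy (hωy.trans hω'.symm), hωx]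
      rintro _ ⟨x, rfl⟩ _ ⟨y, rfl⟩ hxy
      rcases le_total (G.dist o x) (G.dist o y) with hle | hle
      · exact ⟨y, (key x y hle hxy).symm⟩
      · rw [Set.inter_comm] at hxy ⊢
        exact ⟨x, (key y x hle hxy).symm⟩
    · rintro _ ⟨x, rfl⟩
      rw [h₁, h₂]
    · simp

/-- The probability measure `ν` on `Ω` that takes the prescribed values on the sectors. -/
noncomputable def boundaryMeasure {V : Type v} {G : SimpleGraph V} [G.LocallyFinite] {q : ℕ}
    (h : IsHomogeneousTree G q) (o : V) : Measure (Boundary G o) :=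
  (existsUnique_boundaryMeasure h o).choose

theorem boundaryMeasure_sector {V : Type v} {G : SimpleGraph V} [G.LocallyFinite] {q : ℕ}
    (h : IsHomogeneousTree G q) (o x : V) :
    boundaryMeasure h o (sector G o x) = sectorMass G o q x :=
  (existsUnique_boundaryMeasure h o).choose_spec.1.2 x

instance {V : Type v} {G : SimpleGraph V} [G.LocallyFinite] {q : ℕ}
    (h : IsHomogeneousTree G q) (o : V) : IsProbabilityMeasure (boundaryMeasure h o) :=
  (existsUnique_boundaryMeasure h o).choose_spec.1.1

/-- The Poisson kernel `p(x, ω) = q^{2|c(x, ω)| - |x|}`. -/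
noncomputable def poissonKernel {V : Type v} (G : SimpleGraph V) (o : V) (q : ℕ) (x : V)
    (ω : Boundary G o) : ℝ :=
  (q : ℝ) ^ (2 * (G.dist o (confluence G o x ω) : ℤ) - (G.dist o x : ℤ))

/-- The Poisson transform `P_z F(x) = ∫_Ω p^{1/2 + iz}(x, ω) F(ω) dν(ω)`. -/
noncomputable def poissonTransform {V : Type v} {G : SimpleGraph V} [G.LocallyFinite] {q : ℕ}
    (h : IsHomogeneousTree G q) (o : V) (z : ℂ) (F : Boundary G o → ℂ) (x : V) : ℂ :=
  ∫ ω, ((poissonKernel G o q x ω : ℝ) : ℂ) ^ (1 / 2 + Complex.I * z) * F ω ∂(boundaryMeasure h o)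

/-- The Laplacian `L u(x) = u(x) - (1/(q+1)) ∑_{d(x,y)=1} u(y)`. -/
noncomputable def laplacian {V : Type v} (G : SimpleGraph V) [G.LocallyFinite] (q : ℕ)
    (u : V → ℂ) (x : V) : ℂ :=
  u x - 1 / ((q : ℂ) + 1) * ∑ y ∈ G.neighborFinset x, u y

/-- `γ(z) = 1 - (q^{1/2 + iz} + q^{1/2 - iz}) / (q + 1)`. -/
noncomputable def gammaFn (q : ℕ) (z : ℂ) : ℂ :=
  1 - ((q : ℂ) ^ (1 / 2 + Complex.I * z) + (q : ℂ) ^ (1 / 2 - Complex.I * z)) / ((q : ℂ) + 1)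

/-- The Harish-Chandra c-function; used only off its poles, the points of `(τ/2)ℤ`. -/
noncomputable def cFn (q : ℕ) (z : ℂ) : ℂ :=
  (q : ℂ) ^ (1 / 2 : ℂ) / ((q : ℂ) + 1) *
    (((q : ℂ) ^ (1 / 2 + Complex.I * z) - (q : ℂ) ^ (-(1 / 2) - Complex.I * z)) /
      ((q : ℂ) ^ (Complex.I * z) - (q : ℂ) ^ (-(Complex.I * z))))

/-- `τ = 2π / log q`. -/
noncomputable def tau (q : ℕ) : ℝ := 2 * Real.pi / Real.log q

/-- The weak `L^p` quasi-norm `sup_{t > 0} t · #{x : |u(x)| > t}^{1/p}` with respect to the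
counting measure. -/
noncomputable def weakNorm {V : Type v} (p : ℝ) (u : V → ℂ) : ℝ≥0∞ :=
  ⨆ (t : ℝ≥0) (_ : 0 < t), (t : ℝ≥0∞) * ({x : V | t < ‖u x‖₊}.encard : ℝ≥0∞) ^ (1 / p)

/-- Membership in `L^{p,∞}` of the vertex set with the counting measure. -/
def MemWeakL {V : Type v} (p : ℝ) (u : V → ℂ) : Prop :=
  weakNorm p u < ∞

/-- The normalized average
`(q / (2(q+1)|c(z)|²)) (1/n) ∑_{x ∈ B(o,n)} p^{1/2 - iz}(x, ω) u(x)`. -/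
noncomputable def normalizedAverage {V : Type v} (G : SimpleGraph V) (o : V) (q : ℕ) (z : ℂ)
    (u : V → ℂ) (n : ℕ) (ω : Boundary G o) : ℂ :=
  (((q : ℝ) / (2 * ((q : ℝ) + 1) * ‖cFn q z‖ ^ 2) : ℝ) : ℂ) *
    (1 / (n : ℂ) * ∑ᶠ x ∈ ball G o n,
      ((poissonKernel G o q x ω : ℝ) : ℂ) ^ (1 / 2 - Complex.I * z) * u x)

end HomTree

/-! ### Rays, confluence points and sectors. -/

namespace HomTree

universe v

variable {V : Type v} {G : SimpleGraph V} {o : V}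

/-! Put s = q^(1/2+iz). As z is real, |s|² = q and q^(1/2-iz) = q/s is the conjugate of s. Let N_j
be the cardinality of the sphere of radius j.

On a vertex ω'_m the kernel satisfies p^(1/2+iz)(ω'_m, ω) s^m = s^(2|c|), which telescopes into a
sum over j ≤ m of increments of s^(2j) times indicators of the sectors E(ω'_j)
(`poissonKernel_cpow_mul`). So along every ray u = P_z F is a triangular system for the sector
integrals of F, with nonzero diagonal. Solving it for an arbitrary u defines `boundaryMass`. The
eigenvalue equation says exactly that this mass is additive over children
(`sum_children_boundaryMass`), so its densities M_n with respect to ν form a martingale.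

A weak L² function has ∑ |u|² = O(n) over B(o,n) (`exists_sum_sphere_sq_le`). Hence the sum of
‖M_m‖² over m ≤ n is O(n). Since ‖M_n‖² is nondecreasing, it is bounded
(`le_of_monotone_of_sum_le`), and M_n converges in L²(Ω) to some F with the prescribed sector
integrals. Thus u = P_z F. The triangular system also determines the sector integrals of any other
solution, and sectors form a π-system generating the σ-algebra, so F is unique.

For the inversion formula, let D_k be the martingale differences and a_j the j-th increment divided
by N_j. The sum over the sphere of radius m is (N_m/q^m) ∑_{i,j ≤ m} conj(a_j) a_i M_{min(i,j)},
that is, (N_m/q^m) ∑_k |T_{m,k}|² D_k with T_{m,k} = ∑_{k ≤ j ≤ m} a_j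
(`sum_sphere_poissonKernel_cpow_mul`, `sum_sum_min_eq`). From j = 1 on, the a_j are geometric with
ratio w = s²/q = q^(2iz), which has modulus 1 and differs from 1 because z is not in (τ/2)ℤ. This
gives T_{m,k} = c(z)(w^m - η_k) with |η_k| = 1 (`exists_tailCoef_eq`). The average of |w^m - η_k|²
is 2, so the multiplier of each D_k tends to 2(q+1)|c(z)|²/q, boundedly in n and k. By orthogonality
and dominated convergence the normalized averages tend to ∑ D_k = F
(`tendsto_sum_of_pairwise_orthogonal`). -/

theorem Boundary.mem_sector_vertex_iff (hG : G.Connected) (ω ω' : Boundary G o) (n : ℕ) :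
    ω ∈ sector G o (ω'.vertex n) ↔ ω.vertex n = ω'.vertex n := by
  rw [mem_sector_iff hG, Boundary.dist_vertex]

/-- A point of the geodesic from `o` to a vertex of a ray lies on that ray. -/
theorem Boundary.eq_vertex_of_mem_segment (hG : G.IsTree) (ω : Boundary G o) {n : ℕ} :
    ∀ (r : ℕ) (v : V), G.dist v (ω.vertex n) = r → v ∈ segment G o (ω.vertex n) →
      v = ω.vertex (G.dist o v) := by
  intro r
  induction r with
  | zero =>
    intro v hv _
    have h1 := hG.connected.dist_eq_zero_iff.mp hv
    rw [h1, Boundary.dist_vertex]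
  | succ r ih =>
    intro v hv hs
    simp only [segment, Set.mem_ofPred_eq, Boundary.dist_vertex] at hs
    obtain ⟨y, hy, hd⟩ := exists_parent (o := ω.vertex n) hG.connected (x := v) (by
      rintro rfl
      simp at hv)
    rw [SimpleGraph.dist_comm, hv, SimpleGraph.dist_comm] at hd
    have t1 := hG.connected.dist_triangle (u := o) (v := v) (w := y)
    rw [SimpleGraph.dist_eq_one_iff_adj.mpr hy.symm] at t1
    have t2 := hG.connected.dist_triangle (u := o) (v := y) (w := ω.vertex n)
    rw [Boundary.dist_vertex] at t2
    have hy1 : G.dist o y = G.dist o v + 1 := by omega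
    have := ih y (by omega) (by
      simp only [segment, Set.mem_ofPred_eq, Boundary.dist_vertex]
      omega)
    rw [hy1] at this
    refine parent_unique (o := o) hG hy.symm (y' := ω.vertex (G.dist o v)) ?_ hy1 ?_
    · have h3 := ω.adj_vertex (G.dist o v)
      rwa [← this] at h3
    · rw [Boundary.dist_vertex, hy1]

/-- A vertex ω_i with i ≤ m lies on the geodesic from o to ω'_m only if it is ω'_i, and two rays
that agree at one level agree at all earlier ones. Hence |c| counts the common initial steps. -/
theorem vertex_eq_iff_le_dist_confluence (hG : G.IsTree) (ω ω' : Boundary G o) {j m : ℕ}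
    (hj : j ≤ m) :
    ω.vertex j = ω'.vertex j ↔ j ≤ G.dist o (confluence G o (ω'.vertex m) ω) := by
  classical
  have key : ∀ i ≤ m, (ω.vertex i ∈ segment G o (ω'.vertex m) ↔ ω.vertex i = ω'.vertex i) := by
    intro i hi
    constructor
    · intro hmem
      have := Boundary.eq_vertex_of_mem_segment hG ω' _ _ rfl hmem
      rwa [Boundary.dist_vertex] at this
    · intro heq
      simp only [segment, Set.mem_ofPred_eq, heq, Boundary.dist_vertex]
      obtain ⟨k, rfl⟩ := Nat.exists_eq_add_of_le hi
      have : G.dist (ω'.vertex i) (ω'.vertex (i + k)) = k := ω'.2.2 i k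
      rw [this]
  simp only [confluence, Boundary.dist_vertex]
  constructor
  · intro heq
    exact Nat.le_findGreatest hj ((key j hj).mpr heq)
  · intro hle
    rcases Nat.eq_zero_or_pos j with rfl | hpos
    · rw [Boundary.vertex_zero, Boundary.vertex_zero]
    · have hP := Nat.findGreatest_of_ne_zero
        (P := fun j => ω.vertex j ∈ segment G o (ω'.vertex m)) (n := m) rfl (by omega)
      exact vertex_eq_of_le hG _ _ hle ((key _ (Nat.findGreatest_le m)).mp hP)

theorem dist_confluence_le (ω ω' : Boundary G o) (m : ℕ) :
    G.dist o (confluence G o (ω'.vertex m) ω) ≤ m := by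
  classical
  simp only [confluence, Boundary.dist_vertex]
  exact Nat.findGreatest_le m

theorem measurableSet_sector (x : V) : MeasurableSet (sector G o x) :=
  MeasurableSpace.measurableSet_generateFrom ⟨x, rfl⟩

theorem sector_base (hG : G.Connected) : sector G o o = Set.univ := by
  ext ω
  simp [mem_sector_iff hG, Boundary.vertex_zero]

theorem isPiSystem_range_sector (hG : G.IsTree) : IsPiSystem (Set.range (sector G o)) := by
  have key : ∀ x y, G.dist o x ≤ G.dist o y → (sector G o x ∩ sector G o y).Nonempty →
      sector G o x ∩ sector G o y = sector G o y := by
    rintro x y hxy ⟨ω, hωx, hωy⟩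
    rw [mem_sector_iff hG.connected] at hωx hωy
    refine Set.inter_eq_right.mpr fun ω' hω' => ?_
    rw [mem_sector_iff hG.connected] at hω' ⊢
    rw [← vertex_eq_of_le hG ω ω' hxy (hωy.trans hω'.symm), hωx]
  rintro _ ⟨x, rfl⟩ _ ⟨y, rfl⟩ hxy
  rcases le_total (G.dist o x) (G.dist o y) with hle | hle
  · exact ⟨y, (key x y hle hxy).symm⟩
  · rw [Set.inter_comm] at hxy ⊢
    exact ⟨x, (key y x hle hxy).symm⟩

/-- The number of vertices of a sphere of radius `n`. -/
noncomputable def sphereCard (q : ℕ) : ℕ → ℝ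
  | 0 => 1
  | n + 1 => ((q : ℝ) + 1) * (q : ℝ) ^ n

theorem sphereCard_pos {q : ℕ} (hq : 2 ≤ q) (n : ℕ) : 0 < sphereCard q n := by
  have : (0 : ℝ) < q := by exact_mod_cast (by omega : 0 < q)
  cases n <;> simp only [sphereCard] <;> positivity

theorem sphereCard_le {q : ℕ} (hq : 2 ≤ q) (n : ℕ) : sphereCard q n ≤ 2 * (q : ℝ) ^ n := by
  have hq' : (2 : ℝ) ≤ q := by exact_mod_cast hq
  cases n with
  | zero => simp [sphereCard]
  | succ n =>
    have := pow_pos (by linarith : (0 : ℝ) < q) n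
    rw [sphereCard, pow_succ]
    nlinarith

theorem sphereCard_succ_le {q : ℕ} (hq : 2 ≤ q) (n : ℕ) :
    sphereCard q (n + 1) ≤ 2 * q * sphereCard q n := by
  have hq' : (2 : ℝ) ≤ q := by exact_mod_cast hq
  cases n with
  | zero => simp [sphereCard]; linarith
  | succ n =>
    have := pow_pos (by linarith : (0 : ℝ) < q) n
    simp only [sphereCard, pow_succ]
    have : 0 ≤ ((q : ℝ) + 1) * (q ^ n * q) := by positivity
    linarith

variable [G.LocallyFinite] {q : ℕ}

theorem boundaryMeasure_real_sector (h : IsHomogeneousTree G q) (x : V) :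
    (boundaryMeasure h o).real (sector G o x) = (sphereCard q (G.dist o x))⁻¹ := by
  have hG := h.isTree.connected
  rw [measureReal_def, boundaryMeasure_sector, sectorMass]
  split_ifs with hx
  · simp [hx, sphereCard]
  · have hpos := hG.pos_dist_of_ne (Ne.symm hx)
    obtain ⟨k, hk⟩ := Nat.exists_eq_succ_of_ne_zero hpos.ne'
    simp only [hk, Nat.succ_eq_add_one, Nat.add_sub_cancel, sphereCard, ENNReal.toReal_inv,
      ENNReal.toReal_natCast]
    push_cast
    rfl

theorem sector_nonempty (h : IsHomogeneousTree G q) (x : V) : (sector G o x).Nonempty := by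
  refine nonempty_of_measureReal_ne_zero (μ := boundaryMeasure h o) ?_
  rw [boundaryMeasure_real_sector]
  exact (inv_pos.mpr (sphereCard_pos h.two_le _)).ne'

/-- Sectors have positive mass, so they are nonempty. This lets identities at vertices be proved
along rays, where the parent of ω_(n+1) is simply ω_n. -/
theorem exists_ray_through (h : IsHomogeneousTree G q) (x : V) :
    ∃ ω : Boundary G o, ω.vertex (G.dist o x) = x := by
  obtain ⟨ω, hω⟩ := sector_nonempty (o := o) h x
  exact ⟨ω, (mem_sector_iff h.isTree.connected _ _).mp hω⟩

theorem sphere_finite (h : IsHomogeneousTree G q) (o : V) (n : ℕ) :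
    {x | G.dist o x = n}.Finite :=
  (ball_finite h o n).subset fun _ hx => le_of_eq hx

/-- The sphere of radius `n` about `o`. -/
noncomputable def sphere (h : IsHomogeneousTree G q) (o : V) (n : ℕ) : Finset V :=
  (sphere_finite h o n).toFinset

theorem mem_sphere {h : IsHomogeneousTree G q} {n : ℕ} {x : V} :
    x ∈ sphere h o n ↔ G.dist o x = n := by
  simp [sphere]

theorem Boundary.vertex_mem_sphere {h : IsHomogeneousTree G q} (ω : Boundary G o) (n : ℕ) :
    ω.vertex n ∈ sphere h o n := mem_sphere.mpr (ω.dist_vertex n)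

theorem finsum_mem_ball {E : Type*} [AddCommMonoid E] (h : IsHomogeneousTree G q) (n : ℕ)
    (f : V → E) :
    ∑ᶠ x ∈ ball G o n, f x = ∑ m ∈ Finset.range (n + 1), ∑ x ∈ sphere h o m, f x := by
  classical
  rw [finsum_mem_eq_finite_toFinset_sum _ (ball_finite h o n),
    ← Finset.sum_fiberwise_of_maps_to (g := fun x => G.dist o x) (t := Finset.range (n + 1))]
  · refine Finset.sum_congr rfl fun m hm => Finset.sum_congr ?_ fun _ _ => rfl
    ext x
    simp only [Finset.mem_filter, Set.Finite.mem_toFinset, mem_sphere, ball, Set.mem_ofPred_eq,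
      Finset.mem_range] at *
    omega
  · intro x hx
    simp only [Set.Finite.mem_toFinset, ball, Set.mem_ofPred_eq, Finset.mem_range] at *
    omega

/-! ### Integration over sectors and spheres. -/

section Level

variable {E : Type*} [NormedAddCommGroup E]

/-- A function of the `n`-th vertex of a ray is a simple function on the boundary. -/
theorem comp_vertex_eq_sum_indicator (h : IsHomogeneousTree G q) (φ : V → E) (n : ℕ) :
    (fun ω : Boundary G o => φ (ω.vertex n)) =
      fun ω => ∑ x ∈ sphere h o n, (sector G o x).indicator (fun _ => φ x) ω := by
  classical
  ext ω
  rw [Finset.sum_eq_single (ω.vertex n)]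
  · rw [Set.indicator_of_mem]
    rw [Boundary.mem_sector_vertex_iff h.isTree.connected]
  · intro x hx hne
    refine Set.indicator_of_notMem (fun hmem => hne ?_) _
    rw [mem_sector_iff h.isTree.connected, mem_sphere.mp hx] at hmem
    exact hmem.symm
  · intro hn
    exact absurd (ω.vertex_mem_sphere n) hn

theorem memLp_comp_vertex (h : IsHomogeneousTree G q) (φ : V → E) (n : ℕ) (p : ℝ≥0∞) :
    MemLp (fun ω : Boundary G o => φ (ω.vertex n)) p (boundaryMeasure h o) := by
  rw [comp_vertex_eq_sum_indicator h]
  exact memLp_finsetSum _ fun x _ =>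
    memLp_indicator_const p (measurableSet_sector x) _ (Or.inr (measure_ne_top _ _))

theorem integrable_comp_vertex (h : IsHomogeneousTree G q) (φ : V → E) (n : ℕ) :
    Integrable (fun ω : Boundary G o => φ (ω.vertex n)) (boundaryMeasure h o) :=
  memLp_one_iff_integrable.mp (memLp_comp_vertex h φ n 1)

variable [NormedSpace ℝ E]

/-- The integral of a function splits over the sectors of a sphere. -/
theorem integral_eq_sum_sphere (h : IsHomogeneousTree G q) (n : ℕ) {f : Boundary G o → E}
    (hf : Integrable f (boundaryMeasure h o)) :
    ∫ ω, f ω ∂(boundaryMeasure h o) =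
      ∑ x ∈ sphere h o n, ∫ ω in sector G o x, f ω ∂(boundaryMeasure h o) := by
  have hU : (Set.univ : Set (Boundary G o)) = ⋃ x ∈ sphere h o n, sector G o x := by
    refine (Set.eq_univ_of_forall fun ω => ?_).symm
    simp only [Set.mem_iUnion]
    exact ⟨ω.vertex n, ω.vertex_mem_sphere n,
      (Boundary.mem_sector_vertex_iff h.isTree.connected _ _ _).mpr rfl⟩
  rw [← setIntegral_univ, hU, integral_biUnion_finset _ fun x _ => measurableSet_sector x]
  · intro x hx y hy hxy
    refine Set.disjoint_left.mpr fun ω hωx hωy => hxy ?_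
    rw [mem_sector_iff h.isTree.connected, mem_sphere.mp (by simpa using hx)] at hωx
    rw [mem_sector_iff h.isTree.connected, mem_sphere.mp (by simpa using hy)] at hωy
    exact hωx.symm.trans hωy
  · exact fun x _ => hf.integrableOn

/-- The integral over a sector splits over the sectors of the children. -/
theorem setIntegral_sector_eq_sum_children (h : IsHomogeneousTree G q) (x : V)
    {f : Boundary G o → E} (hf : Integrable f (boundaryMeasure h o)) :
    ∫ ω in sector G o x, f ω ∂(boundaryMeasure h o) =
      ∑ y ∈ children G o x, ∫ ω in sector G o y, f ω ∂(boundaryMeasure h o) := by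
  have hG := h.isTree.connected
  have hU : sector G o x = ⋃ y ∈ children G o x, sector G o y := by
    ext ω
    simp only [Set.mem_iUnion, exists_prop, mem_children]
    rw [mem_sector_iff hG]
    constructor
    · intro hx
      refine ⟨ω.vertex (G.dist o x + 1), ⟨?_, ω.dist_vertex _⟩, ?_⟩
      · have := ω.adj_vertex (G.dist o x)
        rwa [hx] at this
      · rw [Boundary.mem_sector_vertex_iff hG]
    · rintro ⟨y, ⟨hadj, hd⟩, hy⟩
      rw [mem_sector_iff hG, hd] at hy
      refine parent_unique (o := o) h.isTree (x := y) ?_ hadj ?_ hd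
      · have := ω.adj_vertex (G.dist o x)
        rwa [hy] at this
      · rw [Boundary.dist_vertex, hd]
  rw [hU, integral_biUnion_finset _ fun x _ => measurableSet_sector x]
  · intro y hy y' hy' hne
    refine Set.disjoint_left.mpr fun ω hω hω' => hne ?_
    rw [mem_sector_iff hG, (mem_children.mp (by simpa using hy)).2] at hω
    rw [mem_sector_iff hG, (mem_children.mp (by simpa using hy')).2] at hω'
    exact hω.symm.trans hω'
  · exact fun x _ => hf.integrableOn

theorem setIntegral_sector_vertex_of_le [CompleteSpace E] (h : IsHomogeneousTree G q) (φ : V → E)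
    (ω : Boundary G o) {i j : ℕ} (hij : i ≤ j) :
    ∫ ω' in sector G o (ω.vertex j), φ (ω'.vertex i) ∂(boundaryMeasure h o) =
      (sphereCard q j)⁻¹ • φ (ω.vertex i) := by
  rw [setIntegral_congr_fun (g := fun _ => φ (ω.vertex i)) (measurableSet_sector _)]
  · rw [setIntegral_const, boundaryMeasure_real_sector, Boundary.dist_vertex]
  · intro ω' hω'
    rw [Boundary.mem_sector_vertex_iff h.isTree.connected] at hω'
    simp only [vertex_eq_of_le h.isTree ω' ω hij hω']

theorem integral_comp_vertex [CompleteSpace E] (h : IsHomogeneousTree G q) (φ : V → E) (n : ℕ) :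
    ∫ ω : Boundary G o, φ (ω.vertex n) ∂(boundaryMeasure h o) =
      (sphereCard q n)⁻¹ • ∑ x ∈ sphere h o n, φ x := by
  rw [integral_eq_sum_sphere h n (integrable_comp_vertex h φ n), Finset.smul_sum]
  refine Finset.sum_congr rfl fun x hx => ?_
  obtain ⟨ω, hω⟩ := exists_ray_through (o := o) h x
  rw [mem_sphere.mp hx] at hω
  have := setIntegral_sector_vertex_of_le h φ ω (le_refl n)
  rwa [hω] at this

end Level

/-- The sectors of a sphere have equal mass and total mass 1, so integrating the constant 1 counts
the vertices. -/
theorem card_sphere (h : IsHomogeneousTree G q) (n : ℕ) :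
    ((sphere h o n).card : ℝ) = sphereCard q n := by
  have := integral_comp_vertex (o := o) h (fun _ => (1 : ℝ)) n
  have hpos := sphereCard_pos h.two_le n
  simp only [integral_const, probReal_univ, smul_eq_mul, mul_one, Finset.sum_const,
    nsmul_eq_mul] at this
  field_simp at this
  exact this.symm

/-- A function whose integrals over all sectors vanish is zero. -/
theorem ae_eq_zero_of_setIntegral_sector (h : IsHomogeneousTree G q) {f : Boundary G o → ℂ}
    (hf : Integrable f (boundaryMeasure h o))
    (h0 : ∀ x, ∫ ω in sector G o x, f ω ∂(boundaryMeasure h o) = 0) :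
    f =ᵐ[boundaryMeasure h o] 0 := by
  refine hf.ae_eq_zero_of_forall_setIntegral_eq_zero fun s hs _ => ?_
  induction s, hs using MeasurableSpace.induction_on_inter
    (h_eq := rfl) (h_inter := isPiSystem_range_sector h.isTree) with
  | empty => simp
  | basic t ht =>
    obtain ⟨x, rfl⟩ := ht
    exact h0 x
  | compl t ht ih =>
    have h1 := integral_add_compl ht hf
    have h2 := h0 o
    rw [sector_base h.isTree.connected, setIntegral_univ] at h2
    rw [ih (measure_lt_top _ _), zero_add, h2] at h1
    exact h1
  | iUnion t hd hm ih =>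
    rw [integral_iUnion hm hd hf.integrableOn]
    simp [fun i => ih i (measure_lt_top _ _)]

end HomTree

/-! ### The Poisson transform as a triangular system, and the boundary value of an eigenfunction. -/

namespace HomTree

universe v

/-- The increments of `s ^ (2 * j)`: the coefficients of the sectors in the Poisson kernel. -/
def increment (s : ℂ) : ℕ → ℂ
  | 0 => 1
  | j + 1 => s ^ (2 * (j + 1)) - s ^ (2 * j)

theorem sum_increment (s : ℂ) (n : ℕ) :
    ∑ j ∈ Finset.range (n + 1), increment s j = s ^ (2 * n) := by
  induction n with
  | zero => simp [increment]
  | succ n ih => rw [Finset.sum_range_succ, ih, increment]; ring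

theorem increment_ne_zero {s : ℂ} (hs0 : s ≠ 0) (hs1 : s ^ 2 ≠ 1) (j : ℕ) :
    increment s j ≠ 0 := by
  cases j with
  | zero => simp [increment]
  | succ j =>
    have : increment s (j + 1) = s ^ (2 * j) * (s ^ 2 - 1) := by rw [increment]; ring
    rw [this]
    exact mul_ne_zero (pow_ne_zero _ hs0) (sub_ne_zero.mpr hs1)

/-- The mass weighted increments. -/
noncomputable def coef (q : ℕ) (s : ℂ) (j : ℕ) : ℂ := increment s j / (sphereCard q j : ℝ)

variable {V : Type v} {G : SimpleGraph V} {o : V}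

open Classical in
/-- The neighbour of `x` closer to `o`. -/
noncomputable def parent (hG : G.Connected) (o x : V) : V :=
  if hx : x = o then o else (exists_parent hG hx).choose

theorem parent_eq (hG : G.IsTree) {x y : V} (hadj : G.Adj y x)
    (hd : G.dist o x = G.dist o y + 1) : parent hG.connected o x = y := by
  have hx : x ≠ o := by
    rintro rfl
    simp at hd
  have hspec := (exists_parent hG.connected hx).choose_spec
  rw [parent, dif_neg hx]
  exact parent_unique (o := o) hG hspec.1 hadj hspec.2 hd

theorem parent_vertex_succ (hG : G.IsTree) (ω : Boundary G o) (n : ℕ) :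
    parent hG.connected o (ω.vertex (n + 1)) = ω.vertex n :=
  parent_eq hG (ω.adj_vertex n) (by simp [Boundary.dist_vertex])

open Classical in
/-- The mass that the finitely additive boundary value of an eigenfunction `u` gives to the
sector `E(x)`. -/
noncomputable def boundaryMass (hG : G.Connected) (o : V) (s : ℂ) (u : V → ℂ) (x : V) : ℂ :=
  if x = o then u o
  else (s ^ G.dist o x * u x - s ^ (G.dist o x - 1) * u (parent hG o x)) /
    increment s (G.dist o x)

/-- The density of the boundary value with respect to the measure of the sector. -/
noncomputable def boundaryDensity (hG : G.Connected) (o : V) (q : ℕ) (s : ℂ) (u : V → ℂ)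
    (x : V) : ℂ :=
  (sphereCard q (G.dist o x) : ℝ) * boundaryMass hG o s u x

theorem boundaryMass_vertex_zero (hG : G.Connected) (s : ℂ) (u : V → ℂ) (ω : Boundary G o) :
    boundaryMass hG o s u (ω.vertex 0) = u o := by
  simp [boundaryMass, Boundary.vertex_zero]

theorem boundaryMass_vertex_succ (hG : G.IsTree) (s : ℂ) (u : V → ℂ) (ω : Boundary G o) (n : ℕ) :
    boundaryMass hG.connected o s u (ω.vertex (n + 1)) =
      (s ^ (n + 1) * u (ω.vertex (n + 1)) - s ^ n * u (ω.vertex n)) / increment s (n + 1) := by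
  have hne : ω.vertex (n + 1) ≠ o := by
    intro heq
    have := ω.dist_vertex (n + 1)
    simp [heq] at this
  rw [boundaryMass, if_neg hne, parent_vertex_succ hG, Boundary.dist_vertex, Nat.add_sub_cancel]

/-- An eigenfunction is the Poisson transform of its boundary value. -/
theorem sum_increment_mul_boundaryMass (hG : G.IsTree) {s : ℂ} (hs0 : s ≠ 0) (hs1 : s ^ 2 ≠ 1)
    (u : V → ℂ) (ω : Boundary G o) (n : ℕ) :
    ∑ j ∈ Finset.range (n + 1),
      increment s j * boundaryMass hG.connected o s u (ω.vertex j) =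
      s ^ n * u (ω.vertex n) := by
  induction n with
  | zero =>
    rw [Finset.sum_range_one, boundaryMass_vertex_zero, Boundary.vertex_zero]
    simp [increment]
  | succ n ih =>
    rw [Finset.sum_range_succ, ih, boundaryMass_vertex_succ hG,
      mul_div_cancel₀ _ (increment_ne_zero hs0 hs1 _)]
    ring

theorem boundaryDensity_vertex (hG : G.Connected) (q : ℕ) (s : ℂ) (u : V → ℂ)
    (ω : Boundary G o) (j : ℕ) :
    boundaryDensity hG o q s u (ω.vertex j) =
      (sphereCard q j : ℝ) * boundaryMass hG o s u (ω.vertex j) := by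
  rw [boundaryDensity, Boundary.dist_vertex]

theorem increment_mul_boundaryMass_eq {q : ℕ} (hq : 2 ≤ q) (hG : G.Connected) (s : ℂ) (u : V → ℂ)
    (ω : Boundary G o) (j : ℕ) :
    increment s j * boundaryMass hG o s u (ω.vertex j) =
      coef q s j * boundaryDensity hG o q s u (ω.vertex j) := by
  have : ((sphereCard q j : ℝ) : ℂ) ≠ 0 := by exact_mod_cast (sphereCard_pos hq j).ne'
  rw [coef, boundaryDensity, Boundary.dist_vertex]
  field_simp

/-- The base is a positive real, so its complex logarithm is the real one and no branch ambiguity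
arises. -/
theorem ofReal_zpow_cpow {q : ℕ} (hq : 2 ≤ q) (k : ℤ) (β : ℂ) :
    (((q : ℝ) ^ k : ℝ) : ℂ) ^ β = ((q : ℂ) ^ β) ^ k := by
  have hq0 : (0 : ℝ) < q := by exact_mod_cast (by omega : 0 < q)
  have hqc : (q : ℂ) ≠ 0 := by exact_mod_cast hq0.ne'
  have h1 : (((q : ℝ) ^ k : ℝ) : ℂ) ≠ 0 := by exact_mod_cast (zpow_pos hq0 k).ne'
  rw [Complex.cpow_def_of_ne_zero h1, Complex.cpow_def_of_ne_zero hqc, ← Complex.exp_int_mul,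
    ← Complex.ofReal_log (zpow_pos hq0 k).le, Real.log_zpow]
  congr 1
  rw [← Complex.natCast_log]
  push_cast
  ring

/-- The left side is (q^β)^(2|c|), and ω lies in E(ω'_j) exactly when j ≤ |c|, so the increments
telescope up to |c|. -/
theorem poissonKernel_cpow_mul {q : ℕ} (hq : 2 ≤ q) (hG : G.IsTree) (β : ℂ) (ω ω' : Boundary G o)
    (m : ℕ) :
    ((poissonKernel G o q (ω'.vertex m) ω : ℝ) : ℂ) ^ β * ((q : ℂ) ^ β) ^ m =
      ∑ j ∈ Finset.range (m + 1),
        increment ((q : ℂ) ^ β) j * (sector G o (ω'.vertex j)).indicator 1 ω := by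
  classical
  have hqc : (q : ℂ) ^ β ≠ 0 := by
    rw [Complex.cpow_ne_zero_iff]
    left
    exact_mod_cast (by omega : q ≠ 0)
  set c := G.dist o (confluence G o (ω'.vertex m) ω) with hc
  have hcm : c ≤ m := dist_confluence_le ω ω' m
  rw [poissonKernel, ofReal_zpow_cpow hq, ← zpow_natCast ((q : ℂ) ^ β) m, ← zpow_add₀ hqc,
    Boundary.dist_vertex, sub_add_cancel, ← hc]
  have h1 : ((q : ℂ) ^ β) ^ (2 * (c : ℤ)) = ((q : ℂ) ^ β) ^ (2 * c) := by
    rw [← zpow_natCast]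
    norm_cast
  rw [h1, ← sum_increment]
  have h2 : ∀ j ∈ Finset.range (m + 1),
      increment ((q : ℂ) ^ β) j * (sector G o (ω'.vertex j)).indicator 1 ω =
        if j ∈ Finset.range (c + 1) then increment ((q : ℂ) ^ β) j else 0 := by
    intro j hj
    have hiff := vertex_eq_iff_le_dist_confluence hG ω ω' (Finset.mem_range_succ_iff.mp hj)
    simp only [Set.indicator_apply, Boundary.mem_sector_vertex_iff hG.connected, hiff,
      Finset.mem_range_succ_iff, ← hc, mul_ite, Pi.one_apply, mul_one, mul_zero]
  rw [Finset.sum_congr rfl h2, ← Finset.sum_filter, Finset.filter_mem_eq_inter,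
    Finset.inter_eq_right.mpr (Finset.range_mono (by omega))]

variable [G.LocallyFinite] {q : ℕ}

theorem poissonTransform_mul (h : IsHomogeneousTree G q) (z : ℂ) {F : Boundary G o → ℂ}
    (hF : Integrable F (boundaryMeasure h o)) (ω : Boundary G o) (m : ℕ) :
    ((q : ℂ) ^ (1 / 2 + Complex.I * z)) ^ m * poissonTransform h o z F (ω.vertex m) =
      ∑ j ∈ Finset.range (m + 1), increment ((q : ℂ) ^ (1 / 2 + Complex.I * z)) j *
        ∫ ω' in sector G o (ω.vertex j), F ω' ∂(boundaryMeasure h o) := by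
  rw [poissonTransform, ← integral_const_mul]
  have h1 : ∀ ω', ((q : ℂ) ^ (1 / 2 + Complex.I * z)) ^ m *
      (((poissonKernel G o q (ω.vertex m) ω' : ℝ) : ℂ) ^ (1 / 2 + Complex.I * z) * F ω') =
      ∑ j ∈ Finset.range (m + 1), increment ((q : ℂ) ^ (1 / 2 + Complex.I * z)) j *
        (sector G o (ω.vertex j)).indicator F ω' := by
    intro ω'
    rw [← mul_assoc, mul_comm (_ ^ m), poissonKernel_cpow_mul h.two_le h.isTree, Finset.sum_mul]
    refine Finset.sum_congr rfl fun j _ => ?_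
    rw [mul_assoc]
    congr 1
    by_cases hmem : ω' ∈ sector G o (ω.vertex j) <;> simp [hmem]
  simp_rw [h1]
  rw [integral_finsetSum]
  · refine Finset.sum_congr rfl fun j _ => ?_
    rw [integral_const_mul, integral_indicator (measurableSet_sector _)]
  · exact fun j _ => (hF.indicator (measurableSet_sector _)).const_mul _

/-- Subtracting consecutive equations isolates the diagonal term, whose increment is nonzero.
Applied to sector integrals, this gives the uniqueness of F. -/
theorem eq_of_sum_increment_mul_eq (h : IsHomogeneousTree G q) {s : ℂ} (hs0 : s ≠ 0) (hs1 : s ^ 2 ≠ 1)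
    {f g : V → ℂ} (hfg : ∀ (ω : Boundary G o) (m : ℕ),
      ∑ j ∈ Finset.range (m + 1), increment s j * f (ω.vertex j) =
        ∑ j ∈ Finset.range (m + 1), increment s j * g (ω.vertex j)) (x : V) : f x = g x := by
  obtain ⟨ω, hω⟩ := exists_ray_through (o := o) h x
  have key : ∀ m, increment s m * f (ω.vertex m) = increment s m * g (ω.vertex m) := by
    intro m
    cases m with
    | zero => simpa using hfg ω 0
    | succ m =>
      have h1 := hfg ω (m + 1)
      rw [Finset.sum_range_succ, Finset.sum_range_succ _ (m + 1), hfg ω m] at h1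
      exact add_left_cancel h1
  have := mul_left_cancel₀ (increment_ne_zero hs0 hs1 _) (key (G.dist o x))
  rwa [hω] at this

/-- The boundary value of an eigenfunction is finitely additive. -/
theorem sum_children_boundaryMass (h : IsHomogeneousTree G q) {s : ℂ} (hs0 : s ≠ 0)
    (hs1 : s ^ 2 ≠ 1) {u : V → ℂ}
    (hu : ∀ x, ∑ y ∈ G.neighborFinset x, u y = (s + q / s) * u x) (x : V) :
    ∑ y ∈ children G o x, boundaryMass h.isTree.connected o s u y =
      boundaryMass h.isTree.connected o s u x := by
  classical
  have hG := h.isTree.connected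
  have hs1' : s ^ 2 - 1 ≠ 0 := sub_ne_zero.mpr hs1
  have hch : ∀ y ∈ children G o x, boundaryMass hG o s u y =
      (s ^ (G.dist o x + 1) * u y - s ^ (G.dist o x) * u x) / increment s (G.dist o x + 1) := by
    intro y hy
    obtain ⟨hadj, hd⟩ := mem_children.mp hy
    have hne : y ≠ o := by
      rintro rfl
      simp at hd
    rw [boundaryMass, if_neg hne, parent_eq h.isTree hadj hd, hd, Nat.add_sub_cancel]
  rw [Finset.sum_congr rfl hch, ← Finset.sum_div, Finset.sum_sub_distrib, ← Finset.mul_sum,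
    Finset.sum_const, card_children h]
  have hinc : ∀ j, increment s (j + 1) = s ^ (2 * j) * (s ^ 2 - 1) := by
    intro j
    rw [increment]
    ring
  by_cases hx : x = o
  · subst hx
    have hnb : ∑ y ∈ children G x x, u y = (s + q / s) * u x := by
      rw [← hu x]
      refine Finset.sum_congr ?_ fun _ _ => rfl
      ext w
      rw [mem_children, SimpleGraph.mem_neighborFinset]
      refine ⟨fun hw => hw.1, fun hw => ⟨hw, ?_⟩⟩
      rw [SimpleGraph.dist_self, SimpleGraph.dist_eq_one_iff_adj.mpr hw]
    rw [hnb, if_pos rfl, boundaryMass, if_pos rfl, SimpleGraph.dist_self, hinc]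
    simp only [nsmul_eq_mul]
    push_cast
    field_simp
    ring
  · obtain ⟨y, hy, hd⟩ := exists_parent hG hx
    -- Away from o one neighbour is the parent y, so the children of x contribute (s + q/s) u(x) -
    -- u(y); at o every neighbour is a child.
    have hE : G.neighborFinset x = insert y (children G o x) := by
      ext w
      rw [Finset.mem_insert, mem_children, SimpleGraph.mem_neighborFinset]
      constructor
      · intro hw
        rcases h.isTree.dist_eq_dist_add_one_of_adj o hw with h1 | h1
        · exact Or.inl (parent_unique (o := o) h.isTree hw.symm hy h1 hd)
        · exact Or.inr ⟨hw, h1⟩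
      · rintro (rfl | hw)
        · exact hy.symm
        · exact hw.1
    have hnot : y ∉ children G o x := by
      rw [mem_children]
      rintro ⟨-, h1⟩
      omega
    have hsum := hu x
    rw [hE, Finset.sum_insert hnot] at hsum
    rw [if_neg hx, boundaryMass, if_neg hx, parent_eq h.isTree hy hd, hd, Nat.add_sub_cancel,
      hinc, hinc, eq_sub_of_add_eq' hsum]
    simp only [nsmul_eq_mul]
    have e1 : s ^ (2 * (G.dist o y + 1)) = s ^ (2 * G.dist o y) * s ^ 2 := by ring
    have e2 : s ^ (G.dist o y + 1 + 1) = s ^ (G.dist o y) * s ^ 2 := by ring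
    have e3 : s ^ (G.dist o y + 1) = s ^ (G.dist o y) * s := by ring
    rw [e1, e2, e3]
    have := pow_ne_zero (2 * G.dist o y) hs0
    field_simp
    ring

/-- The densities of the boundary value form a martingale. -/
theorem setIntegral_boundaryDensity (h : IsHomogeneousTree G q) {s : ℂ} (hs0 : s ≠ 0)
    (hs1 : s ^ 2 ≠ 1) {u : V → ℂ}
    (hu : ∀ x, ∑ y ∈ G.neighborFinset x, u y = (s + q / s) * u x) (r : ℕ) :
    ∀ x, ∫ ω in sector G o x,
        boundaryDensity h.isTree.connected o q s u (ω.vertex (G.dist o x + r))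
          ∂(boundaryMeasure h o) =
      boundaryMass h.isTree.connected o s u x := by
  induction r with
  | zero =>
    intro x
    obtain ⟨ω, hω⟩ := exists_ray_through (o := o) h x
    have h1 := setIntegral_sector_vertex_of_le h
      (boundaryDensity h.isTree.connected o q s u) ω (le_refl (G.dist o x))
    have hpos : ((sphereCard q (G.dist o x) : ℝ) : ℂ) ≠ 0 := by
      exact_mod_cast (sphereCard_pos h.two_le _).ne'
    rw [hω] at h1
    rw [Nat.add_zero, h1, boundaryDensity, Complex.real_smul]
    push_cast
    field_simp
  | succ r ih =>
    intro x
    rw [setIntegral_sector_eq_sum_children h x (integrable_comp_vertex h _ _),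
      ← sum_children_boundaryMass h hs0 hs1 hu x]
    refine Finset.sum_congr rfl fun y hy => ?_
    rw [← ih y, (mem_children.mp hy).2, Nat.add_right_comm, Nat.add_assoc]

theorem setIntegral_boundaryDensity_vertex (h : IsHomogeneousTree G q) {s : ℂ} (hs0 : s ≠ 0)
    (hs1 : s ^ 2 ≠ 1) {u : V → ℂ}
    (hu : ∀ x, ∑ y ∈ G.neighborFinset x, u y = (s + q / s) * u x) (ω : Boundary G o) (i j : ℕ) :
    ∫ ω' in sector G o (ω.vertex j),
        boundaryDensity h.isTree.connected o q s u (ω'.vertex i) ∂(boundaryMeasure h o) =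
      ((sphereCard q j)⁻¹ : ℝ) *
        boundaryDensity h.isTree.connected o q s u (ω.vertex (min i j)) := by
  rcases le_total i j with hij | hij
  · rw [setIntegral_sector_vertex_of_le h _ ω hij, min_eq_left hij, Complex.real_smul]
  · obtain ⟨r, rfl⟩ := Nat.exists_eq_add_of_le hij
    have h1 := setIntegral_boundaryDensity (o := o) h hs0 hs1 hu r (ω.vertex j)
    have hpos : ((sphereCard q j : ℝ) : ℂ) ≠ 0 := by
      exact_mod_cast (sphereCard_pos h.two_le _).ne'
    rw [Boundary.dist_vertex] at h1
    rw [h1, min_eq_right hij, boundaryDensity_vertex]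
    push_cast
    field_simp

/-- The sum over a sphere of an eigenfunction against a power of the Poisson kernel. -/
theorem sum_sphere_poissonKernel_cpow_mul (h : IsHomogeneousTree G q) {s β : ℂ} (hs0 : s ≠ 0)
    (hs1 : s ^ 2 ≠ 1) (hβ : s * (q : ℂ) ^ β = q) {u : V → ℂ}
    (hu : ∀ x, ∑ y ∈ G.neighborFinset x, u y = (s + q / s) * u x) (ω : Boundary G o) (m : ℕ) :
    ∑ x ∈ sphere h o m, ((poissonKernel G o q x ω : ℝ) : ℂ) ^ β * u x =
      (sphereCard q m / (q : ℝ) ^ m : ℝ) *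
        ∑ j ∈ Finset.range (m + 1), ∑ i ∈ Finset.range (m + 1),
          coef q ((q : ℂ) ^ β) j * coef q s i *
            boundaryDensity h.isTree.connected o q s u (ω.vertex (min i j)) := by
  have hG := h.isTree.connected
  have hq0 : (q : ℂ) ≠ 0 := by
    have := h.two_le
    exact_mod_cast (by omega : q ≠ 0)
  have hpos : ∀ j, ((sphereCard q j : ℝ) : ℂ) ≠ 0 := fun j => by
    exact_mod_cast (sphereCard_pos h.two_le _).ne'
  -- All sectors of level m have mass 1/N_m, so the sphere sum is N_m times an integral over a
  -- second ray ω'. Both factors can then be expanded along ω'.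
  have h1 := integral_comp_vertex (o := o) h
    (fun x => ((poissonKernel G o q x ω : ℝ) : ℂ) ^ β * u x) m
  rw [Complex.real_smul, Complex.ofReal_inv, eq_inv_mul_iff_mul_eq₀ (hpos m)] at h1
  rw [← h1, Complex.ofReal_div, div_eq_mul_inv, mul_assoc]
  congr 1
  push_cast
  rw [eq_inv_mul_iff_mul_eq₀ (pow_ne_zero _ hq0), ← integral_const_mul]
  have h2 : ∀ ω' : Boundary G o, (q : ℂ) ^ m *
      (((poissonKernel G o q (ω'.vertex m) ω : ℝ) : ℂ) ^ β * u (ω'.vertex m)) =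
      ∑ j ∈ Finset.range (m + 1), ∑ i ∈ Finset.range (m + 1),
        increment ((q : ℂ) ^ β) j * coef q s i * (sector G o (ω.vertex j)).indicator
          (fun ω' => boundaryDensity hG o q s u (ω'.vertex i)) ω' := by
    intro ω'
    -- The relation s · q^β = q splits q^m into the two powers that turn the kernel and u into their
    -- triangular expansions.
    have e1 : (q : ℂ) ^ m *
      (((poissonKernel G o q (ω'.vertex m) ω : ℝ) : ℂ) ^ β * u (ω'.vertex m)) =
      (((poissonKernel G o q (ω'.vertex m) ω : ℝ) : ℂ) ^ β * ((q : ℂ) ^ β) ^ m) *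
        (s ^ m * u (ω'.vertex m)) := by
      rw [← hβ, mul_pow, hβ]
      ring
    rw [e1, poissonKernel_cpow_mul h.two_le h.isTree,
      ← sum_increment_mul_boundaryMass h.isTree hs0 hs1, Finset.sum_mul_sum]
    refine Finset.sum_congr rfl fun j _ => Finset.sum_congr rfl fun i _ => ?_
    rw [increment_mul_boundaryMass_eq h.two_le, mul_assoc, mul_assoc]
    congr 1
    by_cases hmem : ω' ∈ sector G o (ω.vertex j)
    · have hmem' : ω ∈ sector G o (ω'.vertex j) := by
        rw [Boundary.mem_sector_vertex_iff hG] at hmem ⊢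
        exact hmem.symm
      simp [hmem, hmem']
    · have hmem' : ω ∉ sector G o (ω'.vertex j) := by
        rw [Boundary.mem_sector_vertex_iff hG] at hmem ⊢
        exact fun h' => hmem h'.symm
      simp [hmem, hmem']
  have hint : ∀ i j, Integrable (fun ω' => increment ((q : ℂ) ^ β) j * coef q s i *
      (sector G o (ω.vertex j)).indicator
        (fun ω' => boundaryDensity hG o q s u (ω'.vertex i)) ω') (boundaryMeasure h o) :=
    fun i j => ((integrable_comp_vertex h _ _).indicator (measurableSet_sector _)).const_mul _
  simp_rw [h2]
  rw [integral_finsetSum _ fun j _ => integrable_finsetSum _ fun i _ => hint i j]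
  refine Finset.sum_congr rfl fun j _ => ?_
  rw [integral_finsetSum _ fun i _ => hint i j]
  refine Finset.sum_congr rfl fun i _ => ?_
  rw [integral_const_mul, integral_indicator (measurableSet_sector _),
    setIntegral_boundaryDensity_vertex h hs0 hs1 hu]
  simp only [coef]
  push_cast
  ring

end HomTree

/-! ### From weak L² to an L² bound for the boundary martingale. -/

namespace HomTree

universe v

variable {V : Type v} {G : SimpleGraph V} {o : V}

theorem MemWeakL.sq_mul_card_le {u : V → ℂ} (hu : MemWeakL 2 u) {t : ℝ} (ht : 0 < t)
    {S : Finset V} (hS : ∀ x ∈ S, t < ‖u x‖) :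
    t ^ 2 * S.card ≤ (weakNorm 2 u).toReal ^ 2 := by
  have h1 : (t.toNNReal : ℝ≥0∞) * ((S.card : ℝ≥0∞)) ^ (1 / 2 : ℝ) ≤ weakNorm 2 u := by
    refine le_trans ?_ (le_iSup₂ (f := fun (t : ℝ≥0) (_ : 0 < t) => (t : ℝ≥0∞) *
      ({x : V | t < ‖u x‖₊}.encard : ℝ≥0∞) ^ (1 / 2 : ℝ)) t.toNNReal (Real.toNNReal_pos.mpr ht))
    gcongr
    have h2 : (S : Set V).encard ≤ {x : V | t.toNNReal < ‖u x‖₊}.encard := by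
      refine Set.encard_le_encard fun x hx => ?_
      simp only [Set.mem_ofPred_eq, ← NNReal.coe_lt_coe, coe_nnnorm, Real.coe_toNNReal t ht.le]
      exact hS x hx
    rw [Set.encard_coe_eq_coe_finsetCard] at h2
    exact_mod_cast h2
  have h2 := ENNReal.toReal_mono hu.ne h1
  rw [ENNReal.toReal_mul, ENNReal.coe_toReal, Real.coe_toNNReal t ht.le, ← ENNReal.toReal_rpow,
    ENNReal.toReal_natCast, ← Real.sqrt_eq_rpow] at h2
  have h3 := pow_le_pow_left₀ (by positivity) h2 2
  rwa [mul_pow, Real.sq_sqrt (Nat.cast_nonneg _)] at h3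

/-- Sums of squares of a weak `L²` function grow at most logarithmically in the number of terms. -/
theorem MemWeakL.exists_sum_sq_le {u : V → ℂ} (hu : MemWeakL 2 u) :
    ∃ A : ℝ, 0 < A ∧ ∀ {q : ℝ}, 1 ≤ q → ∀ (n : ℕ) (S : Finset V),
      ∑ x ∈ S, ‖u x‖ ^ 2 ≤ n * (q * A) + S.card * (A / q ^ n) := by
  classical
  set A : ℝ := (weakNorm 2 u).toReal ^ 2 + 1 with hA
  have hA0 : 0 < A := by positivity
  refine ⟨A, hA0, ?_⟩
  intro q hq n S
  have hq0 : 0 < q := by linarith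
  have hcard : ∀ {t : ℝ}, 0 < t → ∀ T : Finset V, (∀ x ∈ T, t < ‖u x‖ ^ 2) → t * T.card ≤ A := by
    intro t ht T hT
    have := hu.sq_mul_card_le (Real.sqrt_pos.mpr ht) (S := T) fun x hx =>
      (Real.sqrt_lt' (lt_of_le_of_ne (norm_nonneg _) fun h0 => by
        have := hT x hx
        rw [← h0] at this
        norm_num at this
        linarith)).mpr (hT x hx)
    rw [Real.sq_sqrt ht.le] at this
    linarith
  -- The layer A/q^(n+1) < |u|² ≤ A/q^n has at most q^(n+1) points, each contributing at most A/q^n,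
  -- hence at most qA in all. No value of |u|² exceeds A, so there are only n layers.
  have hlarge : ∑ x ∈ S with A / q ^ n < ‖u x‖ ^ 2, ‖u x‖ ^ 2 ≤ n * (q * A) := by
    induction n with
    | zero =>
      have hempty : {x ∈ S | A / q ^ 0 < ‖u x‖ ^ 2} = ∅ := by
        refine Finset.filter_eq_empty_iff.mpr fun x _ hx => ?_
        rw [pow_zero, div_one] at hx
        obtain ⟨t, ht1, ht2⟩ := exists_between hx
        have := hcard (hA0.trans ht1) {x} (by simpa using ht2)
        simp at this
        linarith
      rw [hempty]
      simp
    | succ n ih =>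
      have hle : A / q ^ (n + 1) ≤ A / q ^ n := by
        gcongr
        exact Nat.le_succ n
      have hsplit : {x ∈ S | A / q ^ (n + 1) < ‖u x‖ ^ 2} =
          {x ∈ S | A / q ^ n < ‖u x‖ ^ 2} ∪
            {x ∈ S | A / q ^ (n + 1) < ‖u x‖ ^ 2 ∧ ‖u x‖ ^ 2 ≤ A / q ^ n} := by
        ext x
        simp only [Finset.mem_filter, Finset.mem_union, ← and_or_left]
        refine and_congr_right fun _ => ⟨fun hx => ?_, ?_⟩
        · rcases lt_or_ge (A / q ^ n) (‖u x‖ ^ 2) with h1 | h1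
          · exact Or.inl h1
          · exact Or.inr ⟨hx, h1⟩
        · rintro (h1 | h1)
          · exact hle.trans_lt h1
          · exact h1.1
      rw [hsplit, Finset.sum_union]
      · set T := {x ∈ S | A / q ^ (n + 1) < ‖u x‖ ^ 2 ∧ ‖u x‖ ^ 2 ≤ A / q ^ n} with hT
        have h1 : ∑ x ∈ T, ‖u x‖ ^ 2 ≤ T.card • (A / q ^ n) :=
          Finset.sum_le_card_nsmul _ _ _ fun x hx => (Finset.mem_filter.mp hx).2.2
        have h2 := hcard (t := A / q ^ (n + 1)) (by positivity) T
          fun x hx => (Finset.mem_filter.mp hx).2.1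
        have h3 : T.card • (A / q ^ n) = q * (A / q ^ (n + 1) * T.card) := by
          rw [nsmul_eq_mul, pow_succ]
          field_simp
        have h4 := mul_le_mul_of_nonneg_left h2 hq0.le
        push_cast
        linarith
      · refine Finset.disjoint_left.mpr fun x hx hx' => ?_
        have h1 := (Finset.mem_filter.mp hx).2
        have h2 := (Finset.mem_filter.mp hx').2.2
        linarith
  have hsmall : ∑ x ∈ S with ¬ A / q ^ n < ‖u x‖ ^ 2, ‖u x‖ ^ 2 ≤ S.card * (A / q ^ n) := by
    refine (Finset.sum_le_card_nsmul _ _ (A / q ^ n)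
      fun x hx => not_lt.mp (Finset.mem_filter.mp hx).2).trans ?_
    rw [nsmul_eq_mul]
    gcongr
    exact Finset.filter_subset _ _
  rw [← Finset.sum_filter_add_sum_filter_not S (fun x => A / q ^ n < ‖u x‖ ^ 2)]
  linarith

variable [G.LocallyFinite] {q : ℕ}

theorem sum_sphereCard_le (hq : 2 ≤ q) (n : ℕ) :
    ∑ m ∈ Finset.range (n + 1), sphereCard q m ≤ 2 * (q : ℝ) ^ (n + 1) := by
  have hq' : (2 : ℝ) ≤ q := by exact_mod_cast hq
  induction n with
  | zero => simp [sphereCard]; linarith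
  | succ n ih =>
    rw [Finset.sum_range_succ]
    have h1 := sphereCard_le hq (n + 1)
    have h2 : (0 : ℝ) < (q : ℝ) ^ (n + 1) := by positivity
    rw [pow_succ (q : ℝ) (n + 1)]
    nlinarith

/-- The cut-off level A/q^n is matched to the size of the ball, at most 2q^(n+1): the n layers above
it give nqA and the points below it give at most 2qA. -/
theorem exists_sum_sphere_sq_le (h : IsHomogeneousTree G q) (o : V) {u : V → ℂ}
    (hu : MemWeakL 2 u) :
    ∃ K : ℝ, ∀ n : ℕ, ∑ m ∈ Finset.range (n + 1), ∑ x ∈ sphere h o m, ‖u x‖ ^ 2 ≤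
      K * (n + 2) := by
  classical
  obtain ⟨A, hA0, hA⟩ := hu.exists_sum_sq_le
  have hq2 : (2 : ℝ) ≤ q := by exact_mod_cast h.two_le
  refine ⟨q * A, fun n => ?_⟩
  have hdisj : (Finset.range (n + 1) : Set ℕ).PairwiseDisjoint (sphere h o) := by
    intro i _ j _ hij
    refine Finset.disjoint_left.mpr fun x hx hx' => hij ?_
    rw [mem_sphere] at hx hx'
    exact hx.symm.trans hx'
  rw [← Finset.sum_biUnion hdisj]
  refine (hA (q := (q : ℝ)) (by linarith) n _).trans ?_
  have hc : (((Finset.range (n + 1)).biUnion (sphere h o)).card : ℝ) ≤ 2 * (q : ℝ) ^ (n + 1) := by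
    rw [Finset.card_biUnion hdisj]
    push_cast
    simp_rw [card_sphere]
    exact sum_sphereCard_le h.two_le n
  have h1 : (((Finset.range (n + 1)).biUnion (sphere h o)).card : ℝ) * (A / (q : ℝ) ^ n) ≤
      2 * (q : ℝ) ^ (n + 1) * (A / (q : ℝ) ^ n) := by gcongr
  have h2 : 2 * (q : ℝ) ^ (n + 1) * (A / (q : ℝ) ^ n) = 2 * (q * A) := by
    rw [pow_succ]
    field_simp
  linarith

/-- The density at level m+1 is N_(m+1) times a difference of values of u on adjacent spheres,
divided by an increment of modulus q^m |s² - 1|. Its square costs N_(m+1)²/q^m, and integration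
divides by the size of a sphere. Both sizes are comparable to q^m, so the constant does not depend
on m. -/
theorem integral_sq_boundaryDensity_le (h : IsHomogeneousTree G q) {s : ℂ} (hs : ‖s‖ ^ 2 = q)
    (hs1 : s ^ 2 ≠ 1) (u : V → ℂ) (m : ℕ) :
    ∫ ω : Boundary G o, ‖boundaryDensity h.isTree.connected o q s u (ω.vertex (m + 1))‖ ^ 2
        ∂(boundaryMeasure h o) ≤
      8 * q ^ 2 / ‖s ^ 2 - 1‖ ^ 2 *
        (∑ x ∈ sphere h o (m + 1), ‖u x‖ ^ 2 + ∑ x ∈ sphere h o m, ‖u x‖ ^ 2) := by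
  have hq0 : (0 : ℝ) < q := by
    have := h.two_le
    exact_mod_cast (by omega : 0 < q)
  have hd : 0 < ‖s ^ 2 - 1‖ := norm_pos_iff.mpr (sub_ne_zero.mpr hs1)
  have hN1 := sphereCard_pos h.two_le (m + 1)
  have hN0 := sphereCard_pos h.two_le m
  set a := ∑ x ∈ sphere h o (m + 1), ‖u x‖ ^ 2 with ha
  set b := ∑ x ∈ sphere h o m, ‖u x‖ ^ 2 with hb
  have ha0 : 0 ≤ a := Finset.sum_nonneg fun _ _ => by positivity
  have hb0 : 0 ≤ b := Finset.sum_nonneg fun _ _ => by positivity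
  have hpt : ∀ ω : Boundary G o,
      ‖boundaryDensity h.isTree.connected o q s u (ω.vertex (m + 1))‖ ^ 2 ≤
      sphereCard q (m + 1) ^ 2 / ((q : ℝ) ^ m * ‖s ^ 2 - 1‖ ^ 2) * 2 *
        (q * ‖u (ω.vertex (m + 1))‖ ^ 2 + ‖u (ω.vertex m)‖ ^ 2) := by
    intro ω
    have hinc : increment s (m + 1) = s ^ (2 * m) * (s ^ 2 - 1) := by
      rw [increment]
      ring
    have hpow : ∀ k : ℕ, (‖s‖ ^ k) ^ 2 = (q : ℝ) ^ k := fun k => by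
      rw [← pow_mul, mul_comm, pow_mul, hs]
    rw [boundaryDensity_vertex, boundaryMass_vertex_succ h.isTree, hinc, norm_mul, norm_div,
      norm_mul, norm_pow, mul_pow, div_pow, mul_pow, hpow, Complex.norm_real,
      Real.norm_of_nonneg hN1.le]
    have hnum : ‖s ^ (m + 1) * u (ω.vertex (m + 1)) - s ^ m * u (ω.vertex m)‖ ^ 2 ≤
        (q : ℝ) ^ m * (2 * (q * ‖u (ω.vertex (m + 1))‖ ^ 2 + ‖u (ω.vertex m)‖ ^ 2)) := by
      have e1 := norm_sub_le (s ^ (m + 1) * u (ω.vertex (m + 1))) (s ^ m * u (ω.vertex m))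
      rw [norm_mul, norm_mul, norm_pow, norm_pow] at e1
      have e2 := pow_le_pow_left₀ (norm_nonneg _) e1 2
      have e3 := add_pow_le (n := 2) (a := ‖s‖ ^ (m + 1) * ‖u (ω.vertex (m + 1))‖)
        (b := ‖s‖ ^ m * ‖u (ω.vertex m)‖) (by positivity) (by positivity)
      rw [mul_pow, mul_pow, hpow, hpow, pow_succ (q : ℝ) m] at e3
      refine (e2.trans e3).trans (le_of_eq ?_)
      ring
    calc sphereCard q (m + 1) ^ 2 *
          (‖s ^ (m + 1) * u (ω.vertex (m + 1)) - s ^ m * u (ω.vertex m)‖ ^ 2 /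
            ((q : ℝ) ^ (2 * m) * ‖s ^ 2 - 1‖ ^ 2)) ≤ sphereCard q (m + 1) ^ 2 *
          ((q : ℝ) ^ m * (2 * (q * ‖u (ω.vertex (m + 1))‖ ^ 2 + ‖u (ω.vertex m)‖ ^ 2)) /
            ((q : ℝ) ^ (2 * m) * ‖s ^ 2 - 1‖ ^ 2)) := by gcongr
      _ = _ := by
        rw [two_mul m, pow_add]
        field_simp
  have hintu : ∀ k, Integrable (fun ω : Boundary G o => ‖u (ω.vertex k)‖ ^ 2)
      (boundaryMeasure h o) := fun k => integrable_comp_vertex h (fun x => ‖u x‖ ^ 2) k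
  refine (integral_mono (integrable_comp_vertex h
    (fun x => ‖boundaryDensity h.isTree.connected o q s u x‖ ^ 2) _)
    ((((hintu (m + 1)).const_mul q).add (hintu m)).const_mul _) hpt).trans ?_
  have hmain : ∫ ω : Boundary G o, (q * ‖u (ω.vertex (m + 1))‖ ^ 2 + ‖u (ω.vertex m)‖ ^ 2)
      ∂(boundaryMeasure h o) = q * ((sphereCard q (m + 1))⁻¹ * a) + (sphereCard q m)⁻¹ * b := by
    rw [integral_add ((hintu (m + 1)).const_mul _) (hintu m), integral_const_mul,
      integral_comp_vertex h (fun x => ‖u x‖ ^ 2), integral_comp_vertex h (fun x => ‖u x‖ ^ 2),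
      smul_eq_mul, smul_eq_mul]
  simp only [Pi.add_apply]
  rw [integral_const_mul, hmain]
  have hb1 := sphereCard_le h.two_le (m + 1)
  have hb2 := sphereCard_succ_le h.two_le m
  have hqm : (0 : ℝ) < (q : ℝ) ^ m := by positivity
  have key : sphereCard q (m + 1) ^ 2 / (q : ℝ) ^ m *
      (q * ((sphereCard q (m + 1))⁻¹ * a) + (sphereCard q m)⁻¹ * b) ≤ 4 * q ^ 2 * (a + b) := by
    have e1 : sphereCard q (m + 1) ^ 2 / (q : ℝ) ^ m * (q * ((sphereCard q (m + 1))⁻¹ * a)) ≤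
        2 * q ^ 2 * a := by
      have : sphereCard q (m + 1) ^ 2 / (q : ℝ) ^ m * (q * ((sphereCard q (m + 1))⁻¹ * a)) =
          sphereCard q (m + 1) * (q * a / q ^ m) := by field_simp
      rw [this]
      refine (mul_le_mul_of_nonneg_right hb1 (by positivity)).trans (le_of_eq ?_)
      rw [pow_succ]
      field_simp
    have e2 : sphereCard q (m + 1) ^ 2 / (q : ℝ) ^ m * ((sphereCard q m)⁻¹ * b) ≤
        4 * q ^ 2 * b := by
      have : sphereCard q (m + 1) ^ 2 / (q : ℝ) ^ m * ((sphereCard q m)⁻¹ * b) =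
          sphereCard q (m + 1) * sphereCard q (m + 1) * (b / (q ^ m * sphereCard q m)) := by
        field_simp
      rw [this]
      have := mul_le_mul hb1 hb2 hN1.le (by positivity)
      refine (mul_le_mul_of_nonneg_right this (by positivity)).trans (le_of_eq ?_)
      rw [pow_succ]
      field_simp
      ring
    have : 0 ≤ (q : ℝ) ^ 2 * a := by positivity
    rw [mul_add]
    linarith
  calc sphereCard q (m + 1) ^ 2 / ((q : ℝ) ^ m * ‖s ^ 2 - 1‖ ^ 2) * 2 *
        (q * ((sphereCard q (m + 1))⁻¹ * a) + (sphereCard q m)⁻¹ * b) =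
      2 / ‖s ^ 2 - 1‖ ^ 2 * (sphereCard q (m + 1) ^ 2 / (q : ℝ) ^ m *
        (q * ((sphereCard q (m + 1))⁻¹ * a) + (sphereCard q m)⁻¹ * b)) := by
        field_simp
    _ ≤ 2 / ‖s ^ 2 - 1‖ ^ 2 * (4 * q ^ 2 * (a + b)) := by gcongr
    _ = _ := by ring

/-- The n+1 terms with index m from n to 2n are each at least b n, so (n+1) b n ≤ K(2n+3) ≤ 3K(n+1).
-/
theorem le_of_monotone_of_sum_le {b : ℕ → ℝ} (hb : Monotone b) {K : ℝ}
    (hK : ∀ n : ℕ, ∑ m ∈ Finset.range (n + 1), b (m + 1) ≤ K * (n + 3)) (hb0 : 0 ≤ b 0) (n : ℕ) :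
    b n ≤ 3 * K := by
  have h0 : ∀ m, 0 ≤ b m := fun m => hb0.trans (hb (Nat.zero_le m))
  have h1 : ∑ m ∈ Finset.Ico n (2 * n + 1), b n ≤ ∑ m ∈ Finset.Ico n (2 * n + 1), b (m + 1) :=
    Finset.sum_le_sum fun m hm => hb (by
      have := (Finset.mem_Ico.mp hm).1
      omega)
  have h2 : ∑ m ∈ Finset.Ico n (2 * n + 1), b (m + 1) ≤
      ∑ m ∈ Finset.range (2 * n + 1), b (m + 1) := by
    refine Finset.sum_le_sum_of_subset_of_nonneg ?_ fun m _ _ => h0 _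
    intro m hm
    simp only [Finset.mem_Ico, Finset.mem_range] at *
    omega
  have h3 := hK (2 * n)
  have hK0 : 0 ≤ K := by
    have := hK 0
    have h4 := h0 1
    simp at this
    linarith
  rw [Finset.sum_const, Nat.card_Ico, nsmul_eq_mul] at h1
  have h5 : ((2 * n + 1 - n : ℕ) : ℝ) = n + 1 := by
    rw [show 2 * n + 1 - n = n + 1 by omega]
    push_cast
    rfl
  rw [h5] at h1
  push_cast at h3
  have hn : (0 : ℝ) ≤ n := Nat.cast_nonneg n
  nlinarith [mul_nonneg hK0 hn]

end HomTree

/-! ### Orthogonal series with convergent multipliers, and Cesàro averages. -/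

namespace HomTree

universe v

section Hilbert

variable {H : Type*} [NormedAddCommGroup H] [InnerProductSpace ℂ H]

theorem norm_sum_smul_sq {D : ℕ → H} (hD : Pairwise fun i j => inner ℂ (D i) (D j) = 0)
    (c : ℕ → ℂ) (S : Finset ℕ) :
    ‖∑ k ∈ S, c k • D k‖ ^ 2 = ∑ k ∈ S, ‖c k‖ ^ 2 * ‖D k‖ ^ 2 := by
  classical
  induction S using Finset.induction_on with
  | empty => simp
  | insert k S hk ih =>
    rw [Finset.sum_insert hk, Finset.sum_insert hk, ← ih, ← mul_pow, ← norm_smul]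
    have h0 : inner ℂ (c k • D k) (∑ i ∈ S, c i • D i) = 0 := by
      rw [inner_sum]
      refine Finset.sum_eq_zero fun i hi => ?_
      rw [inner_smul_left, inner_smul_right, hD (by rintro rfl; exact hk hi)]
      simp
    have := norm_add_sq_eq_norm_sq_add_norm_sq_of_inner_eq_zero _ _ h0
    simpa only [sq] using this

variable [CompleteSpace H]

/-- By Pythagoras, replacing the multipliers by κ costs at most ∑ (lam n k - κ)² ‖D k‖² in squared
norm. This tends to 0 by dominated convergence, so pointwise convergence in k with a common bound is
enough. -/
theorem tendsto_sum_of_pairwise_orthogonal {D : ℕ → H}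
    (hD : Pairwise fun i j => inner ℂ (D i) (D j) = 0) {C : ℝ}
    (hC : ∀ n, ∑ k ∈ Finset.range (n + 1), ‖D k‖ ^ 2 ≤ C) :
    ∃ F, Tendsto (fun n => ∑ k ∈ Finset.range (n + 1), D k) atTop (𝓝 F) ∧
      ∀ {lam : ℕ → ℕ → ℝ} {κ B : ℝ}, (∀ n k, |lam n k| ≤ B) →
        (∀ k, Tendsto (fun n => lam n k) atTop (𝓝 κ)) →
        Tendsto (fun n => ∑ k ∈ Finset.range (n + 1), (lam n k : ℂ) • D k) atTop
          (𝓝 ((κ : ℂ) • F)) := by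
  have hsum : Summable fun k => ‖D k‖ ^ 2 := by
    refine summable_of_sum_range_le (c := C) (fun _ => by positivity) fun n => ?_
    refine le_trans ?_ (hC n)
    rw [Finset.sum_range_succ]
    have : 0 ≤ ‖D n‖ ^ 2 := by positivity
    linarith
  -- The spans are used because some D i may vanish, which rules out normalizing them.
  have hV : OrthogonalFamily ℂ (fun i => Submodule.span ℂ {D i})
      (fun i => (Submodule.span ℂ {D i}).subtypeₗᵢ) := by
    refine OrthogonalFamily.of_pairwise fun i j hij => ?_
    rw [Function.onFun, Submodule.isOrtho_span]
    rintro _ rfl _ rfl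
    exact hD hij
  have hDs : Summable D := by
    have := (hV.summable_iff_norm_sq_summable
      (fun i => ⟨D i, Submodule.mem_span_singleton_self _⟩)).mpr (by simpa using hsum)
    simpa using this
  have hF : Tendsto (fun n => ∑ k ∈ Finset.range (n + 1), D k) atTop (𝓝 (∑' k, D k)) :=
    hDs.hasSum.tendsto_sum_nat.comp (tendsto_add_atTop_nat 1)
  refine ⟨_, hF, ?_⟩
  intro lam κ B hB hlam
  have hdiff : Tendsto (fun n => ∑ k ∈ Finset.range (n + 1), ((lam n k - κ : ℝ) : ℂ) • D k) atTop
      (𝓝 0) := by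
    have hts : Tendsto (fun n => ∑' k, (lam n k - κ) ^ 2 * ‖D k‖ ^ 2) atTop
        (𝓝 (∑' _ : ℕ, (0 : ℝ))) := by
      refine tendsto_tsum_of_dominated_convergence
        (bound := fun k => (B + |κ|) ^ 2 * ‖D k‖ ^ 2) (hsum.mul_left _) ?_ ?_
      · intro k
        have := (((hlam k).sub_const κ).pow 2).mul_const (‖D k‖ ^ 2)
        simpa using this
      · refine Eventually.of_forall fun n k => ?_
        rw [norm_mul, norm_pow, norm_pow, norm_norm, Real.norm_eq_abs]
        gcongr
        exact (abs_sub _ _).trans (by gcongr; exact hB n k)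
    rw [tsum_zero] at hts
    have hle : ∀ n, ‖∑ k ∈ Finset.range (n + 1), ((lam n k - κ : ℝ) : ℂ) • D k‖ ≤
        √(∑' k, (lam n k - κ) ^ 2 * ‖D k‖ ^ 2) := by
      intro n
      refine Real.le_sqrt_of_sq_le ?_
      rw [norm_sum_smul_sq hD (fun k => ((lam n k - κ : ℝ) : ℂ))]
      simp only [Complex.norm_real, Real.norm_eq_abs, sq_abs]
      refine Summable.sum_le_tsum _ (fun _ _ => by positivity) ?_
      refine Summable.of_nonneg_of_le (fun _ => by positivity) (fun k => ?_)
        (hsum.mul_left ((B + |κ|) ^ 2))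
      rw [← sq_abs (lam n k - κ)]
      gcongr
      exact (abs_sub _ _).trans (by gcongr; exact hB n k)
    refine squeeze_zero_norm hle ?_
    simpa [Function.comp_def] using (Real.continuous_sqrt.tendsto 0).comp hts
  have := hdiff.add (hF.const_smul (κ : ℂ))
  rw [zero_add] at this
  refine this.congr fun n => ?_
  rw [Finset.smul_sum, ← Finset.sum_add_distrib]
  refine Finset.sum_congr rfl fun k _ => ?_
  rw [← add_smul]
  push_cast
  rw [sub_add_cancel]

end Hilbert

/-- Averages of an almost periodic sequence. -/
theorem tendsto_average_of_eventually_eq {w θ : ℂ} (hw : ‖w‖ = 1) (hw1 : w ≠ 1) {f : ℕ → ℝ}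
    {l : ℝ} (hf : ∀ᶠ m in atTop, f m = l + (w ^ m * θ).re) :
    Tendsto (fun n : ℕ => (n : ℝ)⁻¹ * ∑ m ∈ Finset.range (n + 1), f m) atTop (𝓝 l) := by
  have hr : Tendsto (fun m => f m - (w ^ m * θ).re) atTop (𝓝 l) :=
    tendsto_const_nhds.congr' (hf.mono fun m hm => by simp only [hm]; ring)
  -- Since w has modulus 1 and w ≠ 1, the geometric sums stay bounded by 2/|w - 1|.
  have hosc : Tendsto (fun n : ℕ => (n : ℝ)⁻¹ * ∑ m ∈ Finset.range n, (w ^ m * θ).re) atTop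
      (𝓝 0) := by
    have hbd : ∀ n : ℕ, ‖(n : ℝ)⁻¹ * ∑ m ∈ Finset.range n, (w ^ m * θ).re‖ ≤
        (n : ℝ)⁻¹ * (2 / ‖w - 1‖ * ‖θ‖) := by
      intro n
      rw [norm_mul, norm_inv, Real.norm_natCast, ← Complex.re_sum, ← Finset.sum_mul,
        geom_sum_eq hw1]
      gcongr
      refine (Complex.abs_re_le_norm _).trans ?_
      rw [norm_mul, norm_div]
      gcongr
      refine (norm_sub_le _ _).trans ?_
      rw [norm_pow, hw]
      norm_num
    refine squeeze_zero_norm hbd ?_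
    simpa using (tendsto_inv_atTop_nhds_zero_nat (𝕜 := ℝ)).mul_const (2 / ‖w - 1‖ * ‖θ‖)
  have h1 : Tendsto (fun n : ℕ => (n : ℝ)⁻¹ * ∑ m ∈ Finset.range n, f m) atTop (𝓝 l) := by
    have := hr.cesaro.add hosc
    rw [add_zero] at this
    refine this.congr fun n => ?_
    rw [← mul_add, ← Finset.sum_add_distrib]
    simp
  -- The sum has n+1 terms but is divided by n; the factor 1 + 1/n corrects for this.
  have h2 := (h1.comp (tendsto_add_atTop_nat 1)).mul
    ((tendsto_const_nhds (x := (1 : ℝ))).add (tendsto_inv_atTop_nhds_zero_nat (𝕜 := ℝ)))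
  rw [add_zero, mul_one] at h2
  refine h2.congr' ((eventually_gt_atTop 0).mono fun n hn => ?_)
  have hn' : (n : ℝ) ≠ 0 := by exact_mod_cast hn.ne'
  have hn1 : (n : ℝ) + 1 ≠ 0 := by positivity
  simp only [Function.comp_apply]
  push_cast
  field_simp

end HomTree

/-! ### The parameters s, w and c(z), and the multipliers of the averages. -/

namespace HomTree

universe v

section Parameters

variable {q : ℕ}

theorem natCast_cpow_mul_cpow (hq : 2 ≤ q) (z : ℂ) :
    (q : ℂ) ^ (1 / 2 + Complex.I * z) * (q : ℂ) ^ (1 / 2 - Complex.I * z) = q := by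
  have hq0 : (q : ℂ) ≠ 0 := by exact_mod_cast (by omega : q ≠ 0)
  rw [← Complex.cpow_add _ _ hq0]
  ring_nf
  exact Complex.cpow_one _

theorem norm_natCast_cpow_sq (hq : 2 ≤ q) (z : ℝ) :
    ‖(q : ℂ) ^ (1 / 2 + Complex.I * z)‖ ^ 2 = q := by
  have hq0 : (0 : ℝ) < q := by exact_mod_cast (by omega : 0 < q)
  rw [Complex.norm_natCast_cpow_of_pos (by omega), ← Real.rpow_natCast, ← Real.rpow_mul hq0.le]
  simp

theorem conj_natCast_cpow (hq : 2 ≤ q) (z : ℝ) :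
    (starRingEnd ℂ) ((q : ℂ) ^ (1 / 2 + Complex.I * z)) = (q : ℂ) ^ (1 / 2 - Complex.I * z) := by
  have hne : (q : ℂ) ^ (1 / 2 + Complex.I * z) ≠ 0 := by
    rw [Complex.cpow_ne_zero_iff]
    left
    exact_mod_cast (by omega : q ≠ 0)
  refine mul_left_cancel₀ hne ?_
  rw [natCast_cpow_mul_cpow hq, Complex.mul_conj, Complex.normSq_eq_norm_sq,
    norm_natCast_cpow_sq hq]
  simp

theorem sq_ne_one_of_norm_sq {s : ℂ} (hq : 2 ≤ q) (hs : ‖s‖ ^ 2 = q) : s ^ 2 ≠ 1 := by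
  intro h1
  have := congrArg norm h1
  rw [norm_pow, hs, norm_one] at this
  have : q = 1 := by exact_mod_cast this
  omega

theorem natCast_cpow_sq_div (hq : 2 ≤ q) (z : ℂ) :
    ((q : ℂ) ^ (1 / 2 + Complex.I * z)) ^ 2 / q = ((q : ℂ) ^ (Complex.I * z)) ^ 2 := by
  have hq0 : (q : ℂ) ≠ 0 := by exact_mod_cast (by omega : q ≠ 0)
  rw [Complex.cpow_add _ _ hq0, mul_pow, ← Complex.cpow_nat_mul, Nat.cast_ofNat,
    mul_one_div_cancel two_ne_zero, Complex.cpow_one, mul_div_cancel_left₀ _ hq0]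

/-- The quotient is exp(2iz log q), which equals 1 only for z in (π/log q)ℤ = (τ/2)ℤ. -/
theorem natCast_cpow_sq_div_ne_one (hq : 2 ≤ q) {z : ℝ}
    (hz : ∀ k : ℤ, z ≠ (k : ℝ) * (tau q / 2)) :
    ((q : ℂ) ^ (1 / 2 + Complex.I * z)) ^ 2 / q ≠ 1 := by
  have hq0 : (q : ℂ) ≠ 0 := by exact_mod_cast (by omega : q ≠ 0)
  have hlog : Real.log q ≠ 0 := (Real.log_pos (by exact_mod_cast (by omega : 1 < q))).ne'
  rw [natCast_cpow_sq_div hq, Complex.cpow_def_of_ne_zero hq0, ← Complex.exp_nat_mul]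
  intro h1
  obtain ⟨k, hk⟩ := Complex.exp_eq_one_iff.mp h1
  refine hz k ?_
  have h2 : ((2 * (Real.log q * z) : ℝ) : ℂ) * Complex.I =
      ((k * (2 * Real.pi) : ℝ) : ℂ) * Complex.I := by
    push_cast
    push_cast at hk
    linear_combination hk
  have h3 : 2 * (Real.log q * z) = k * (2 * Real.pi) := by
    exact_mod_cast mul_right_cancel₀ Complex.I_ne_zero h2
  rw [tau]
  field_simp
  linarith

/-- In this form c(z) is the prefactor of the geometric sum of the coefficients: (s² - 1)/(q + 1)
divided by w - 1. -/
theorem cFn_eq (hq : 2 ≤ q) {z : ℂ} (hz : ((q : ℂ) ^ (1 / 2 + Complex.I * z)) ^ 2 / q ≠ 1) :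
    cFn q z = (((q : ℂ) ^ (1 / 2 + Complex.I * z)) ^ 2 - 1) / (q + 1) /
      (((q : ℂ) ^ (1 / 2 + Complex.I * z)) ^ 2 / q - 1) := by
  have hq0 : (q : ℂ) ≠ 0 := by exact_mod_cast (by omega : q ≠ 0)
  have hq1 : (q : ℂ) + 1 ≠ 0 := by exact_mod_cast (by omega : q + 1 ≠ 0)
  rw [natCast_cpow_sq_div hq] at hz ⊢
  have hneg : (-(1 / 2) - Complex.I * z : ℂ) = -(1 / 2 + Complex.I * z) := by ring
  rw [cFn, hneg, Complex.cpow_neg, Complex.cpow_neg, Complex.cpow_add _ _ hq0]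
  have hr : (q : ℂ) ^ (1 / 2 : ℂ) ≠ 0 := by
    rw [Complex.cpow_ne_zero_iff]
    exact Or.inl hq0
  have hv : (q : ℂ) ^ (Complex.I * z) ≠ 0 := by
    rw [Complex.cpow_ne_zero_iff]
    exact Or.inl hq0
  set r := (q : ℂ) ^ (1 / 2 : ℂ)
  set v := (q : ℂ) ^ (Complex.I * z)
  have hv1 : v ^ 2 - 1 ≠ 0 := sub_ne_zero.mpr hz
  have e1 : v - v⁻¹ = (v ^ 2 - 1) / v := by field_simp
  have e2 : r * v - (r * v)⁻¹ = ((r * v) ^ 2 - 1) / (r * v) := by field_simp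
  rw [e1, e2]
  field_simp

end Parameters

/-- The multiplier of the `k`-th martingale difference in the expansion of an eigenfunction on
the sphere of radius `m`. -/
noncomputable def tailCoef (q : ℕ) (s : ℂ) (m k : ℕ) : ℂ :=
  ∑ j ∈ Finset.range (m + 1), if k ≤ j then coef q s j else 0

theorem tailCoef_of_lt (q : ℕ) (s : ℂ) {m k : ℕ} (hmk : m < k) : tailCoef q s m k = 0 :=
  Finset.sum_eq_zero fun j hj => if_neg (by
    have := Finset.mem_range.mp hj
    omega)

theorem tailCoef_succ (q : ℕ) (s : ℂ) {m k : ℕ} (hkm : k ≤ m + 1) :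
    tailCoef q s (m + 1) k = tailCoef q s m k + coef q s (m + 1) := by
  rw [tailCoef, Finset.sum_range_succ, if_pos hkm, tailCoef]

theorem coef_succ {q : ℕ} (hq : 2 ≤ q) (s : ℂ) (j : ℕ) :
    coef q s (j + 1) = (s ^ 2 / q) ^ j * ((s ^ 2 - 1) / (q + 1)) := by
  have hq0 : (q : ℂ) ≠ 0 := by exact_mod_cast (by omega : q ≠ 0)
  have hq1 : (q : ℂ) + 1 ≠ 0 := by exact_mod_cast (by omega : q + 1 ≠ 0)
  rw [coef, increment, sphereCard]
  push_cast
  rw [div_pow, ← pow_mul]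
  field_simp
  ring

/-- For k ≥ 1 this is a geometric sum and η = w^(k-1). For k = 0 the extra term a_0 = 1 breaks the
pattern, but η still has modulus 1. This makes the limiting multiplier independent of k. -/
theorem exists_tailCoef_eq {q : ℕ} (hq : 2 ≤ q) {s : ℂ} (hs : ‖s‖ ^ 2 = q) (hw : s ^ 2 / q ≠ 1)
    (k : ℕ) :
    ∃ η : ℂ, ‖η‖ = 1 ∧ ∀ m, k ≤ m → tailCoef q s m k =
      (s ^ 2 - 1) / (q + 1) / (s ^ 2 / q - 1) * ((s ^ 2 / q) ^ m - η) := by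
  have hq0 : (q : ℂ) ≠ 0 := by exact_mod_cast (by omega : q ≠ 0)
  have hq1 : (q : ℂ) + 1 ≠ 0 := by exact_mod_cast (by omega : q + 1 ≠ 0)
  have hs1 : s ^ 2 - 1 ≠ 0 := sub_ne_zero.mpr (sq_ne_one_of_norm_sq hq hs)
  have hw1 : s ^ 2 / q - 1 ≠ 0 := sub_ne_zero.mpr hw
  have hwn : ‖s ^ 2 / q‖ = 1 := by
    rw [norm_div, norm_pow, hs, Complex.norm_natCast, div_self]
    exact_mod_cast (by omega : q ≠ 0)
  suffices hbase : ∃ η : ℂ, ‖η‖ = 1 ∧ tailCoef q s k k =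
      (s ^ 2 - 1) / (q + 1) / (s ^ 2 / q - 1) * ((s ^ 2 / q) ^ k - η) by
    obtain ⟨η, hη, hk⟩ := hbase
    refine ⟨η, hη, fun m hm => ?_⟩
    induction m, hm using Nat.le_induction with
    | base => exact hk
    | succ m hm ih =>
      rw [tailCoef_succ q s (by omega), ih, coef_succ hq, pow_succ]
      have h1 : (s ^ 2 - 1) / (q + 1) =
          (s ^ 2 - 1) / (q + 1) / (s ^ 2 / q - 1) * (s ^ 2 / q - 1) :=
        (div_mul_cancel₀ _ hw1).symm
      linear_combination (s ^ 2 / (q : ℂ)) ^ m * h1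
  cases k with
  | zero =>
    -- This η is forced by the value 1 at m = 0. With s² = qw and |w| = 1, the identity qw - 1 = w ·
    -- conj(q - w) gives |η| = 1.
    refine ⟨(q - s ^ 2 / q) / (s ^ 2 - 1), ?_, ?_⟩
    · have hsw : s ^ 2 = q * (s ^ 2 / q) := by field_simp
      have hnorm : ‖(q : ℂ) - s ^ 2 / q‖ = ‖s ^ 2 - 1‖ := by
        rw [hsw]
        simp only [mul_div_cancel_left₀ _ hq0]
        generalize hW : s ^ 2 / (q : ℂ) = w at *
        have e1 : (q : ℂ) * w - 1 = w * (starRingEnd ℂ) ((q : ℂ) - w) := by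
          rw [map_sub, mul_sub, Complex.mul_conj, Complex.normSq_eq_norm_sq, hwn]
          simp
          ring
        rw [e1, norm_mul, hwn, one_mul, Complex.norm_conj]
      rw [norm_div, hnorm, div_self (norm_ne_zero_iff.mpr hs1)]
    · have hsw : s ^ 2 = q * (s ^ 2 / q) := by field_simp
      simp only [tailCoef, zero_add, Finset.sum_range_one, le_refl, if_true, coef, increment,
        sphereCard, Complex.ofReal_one, div_one, pow_zero]
      have e1 : 1 - ((q : ℂ) - s ^ 2 / q) / (s ^ 2 - 1) =
          (q + 1) * (s ^ 2 / q - 1) / (s ^ 2 - 1) := by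
        rw [eq_div_iff hs1, sub_mul, div_mul_cancel₀ _ hs1]
        linear_combination hsw
      rw [e1]
      generalize hW : s ^ 2 / (q : ℂ) = w at *
      field_simp
  | succ k =>
    refine ⟨(s ^ 2 / q) ^ k, by rw [norm_pow, hwn, one_pow], ?_⟩
    rw [tailCoef_succ q s le_rfl, tailCoef_of_lt q s (Nat.lt_succ_self k), zero_add,
      coef_succ hq, pow_succ]
    have h1 : (s ^ 2 - 1) / (q + 1) =
        (s ^ 2 - 1) / (q + 1) / (s ^ 2 / q - 1) * (s ^ 2 / q - 1) :=
      (div_mul_cancel₀ _ hw1).symm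
    linear_combination (s ^ 2 / (q : ℂ)) ^ k * h1

theorem norm_sub_sq_of_norm_one {a b : ℂ} (ha : ‖a‖ = 1) (hb : ‖b‖ = 1) :
    ‖a - b‖ ^ 2 = 2 + (a * (-2 * (starRingEnd ℂ) b)).re := by
  rw [← Complex.normSq_eq_norm_sq, Complex.normSq_sub, Complex.normSq_eq_norm_sq,
    Complex.normSq_eq_norm_sq, ha, hb]
  simp [Complex.mul_re]
  ring

/-- The multiplier of the `k`-th martingale difference in the averages over balls. -/
noncomputable def averageCoef (q : ℕ) (s : ℂ) (n k : ℕ) : ℝ :=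
  (n : ℝ)⁻¹ * ∑ m ∈ Finset.range (n + 1),
    sphereCard q m / (q : ℝ) ^ m * ‖tailCoef q s m k‖ ^ 2

/-- The constant 16 is 2 · 4 · 2, from N_m/q^m ≤ 2, |w^m - η|² ≤ 4 and (n+1)/n ≤ 2. -/
theorem abs_averageCoef_le {q : ℕ} (hq : 2 ≤ q) {s : ℂ} (hs : ‖s‖ ^ 2 = q)
    (hw : s ^ 2 / q ≠ 1) (n k : ℕ) :
    |averageCoef q s n k| ≤ 16 * ‖(s ^ 2 - 1) / (q + 1) / (s ^ 2 / q - 1)‖ ^ 2 := by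
  have hq0 : (0 : ℝ) < q := by exact_mod_cast (by omega : 0 < q)
  have hwn : ‖s ^ 2 / q‖ = 1 := by
    rw [norm_div, norm_pow, hs, Complex.norm_natCast, div_self hq0.ne']
  obtain ⟨η, hη, hk⟩ := exists_tailCoef_eq hq hs hw k
  set B := ‖(s ^ 2 - 1) / (q + 1) / (s ^ 2 / q - 1)‖ ^ 2 with hB
  have hB0 : 0 ≤ B := by positivity
  have hterm : ∀ m, sphereCard q m / (q : ℝ) ^ m * ‖tailCoef q s m k‖ ^ 2 ≤ 8 * B := by
    intro m
    have h1 : sphereCard q m / (q : ℝ) ^ m ≤ 2 := by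
      rw [div_le_iff₀ (by positivity)]
      exact sphereCard_le hq m
    have h2 : ‖tailCoef q s m k‖ ^ 2 ≤ 4 * B := by
      rcases lt_or_ge m k with hmk | hmk
      · rw [tailCoef_of_lt q s hmk, norm_zero]
        norm_num
        exact hB0
      · rw [hk m hmk, norm_mul, mul_pow, ← hB]
        have : ‖(s ^ 2 / (q : ℂ)) ^ m - η‖ ≤ 2 := by
          refine (norm_sub_le _ _).trans ?_
          rw [norm_pow, hwn, hη]
          norm_num
        have := pow_le_pow_left₀ (norm_nonneg _) this 2
        nlinarith
    have h3 := mul_le_mul h1 h2 (by positivity) (by norm_num)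
    linarith
  have hnn : ∀ m, 0 ≤ sphereCard q m / (q : ℝ) ^ m * ‖tailCoef q s m k‖ ^ 2 := fun m => by
    have := (sphereCard_pos hq m).le
    positivity
  rw [averageCoef, abs_of_nonneg (mul_nonneg (by positivity) (Finset.sum_nonneg fun m _ => hnn m))]
  -- For n = 0 the average is 0, since the inverse of 0 is 0.
  rcases Nat.eq_zero_or_pos n with rfl | hn
  · simpa using hB0
  · have hn' : (1 : ℝ) ≤ n := by exact_mod_cast hn
    rw [inv_mul_le_iff₀ (by linarith)]
    refine (Finset.sum_le_card_nsmul _ _ _ fun m _ => hterm m).trans ?_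
    rw [Finset.card_range, nsmul_eq_mul]
    push_cast
    nlinarith

/-- Expanding |w^m - η|² = 2 - 2 Re(w^m conj η) leaves the constant 2 after averaging, times |c(z)|²
and N_m/q^m = (q+1)/q. -/
theorem tendsto_averageCoef {q : ℕ} (hq : 2 ≤ q) {s : ℂ} (hs : ‖s‖ ^ 2 = q)
    (hw : s ^ 2 / q ≠ 1) (k : ℕ) :
    Tendsto (fun n => averageCoef q s n k) atTop
      (𝓝 (2 * ((q : ℝ) + 1) * ‖(s ^ 2 - 1) / (q + 1) / (s ^ 2 / q - 1)‖ ^ 2 / q)) := by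
  have hq0 : (0 : ℝ) < q := by exact_mod_cast (by omega : 0 < q)
  have hwn : ‖s ^ 2 / q‖ = 1 := by
    rw [norm_div, norm_pow, hs, Complex.norm_natCast, div_self hq0.ne']
  obtain ⟨η, hη, hk⟩ := exists_tailCoef_eq hq hs hw k
  set B := ‖(s ^ 2 - 1) / (q + 1) / (s ^ 2 / q - 1)‖ ^ 2 with hB
  refine tendsto_average_of_eventually_eq (w := s ^ 2 / q)
    (θ := (((q + 1) / q * B : ℝ) : ℂ) * (-2 * (starRingEnd ℂ) η)) hwn hw ?_
  -- The level m = 0 is dropped because N_0 = 1 does not follow the formula (q+1)q^(m-1).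
  filter_upwards [eventually_ge_atTop k, eventually_gt_atTop 0] with m hm hm0
  obtain ⟨m, rfl⟩ := Nat.exists_eq_succ_of_ne_zero hm0.ne'
  have e1 : sphereCard q m.succ / (q : ℝ) ^ m.succ = (q + 1) / q := by
    rw [Nat.succ_eq_add_one, sphereCard, pow_succ]
    field_simp
  rw [e1, hk _ hm, norm_mul, mul_pow, ← hB,
    norm_sub_sq_of_norm_one (by rw [norm_pow, hwn, one_pow]) hη]
  have e2 : ∀ (r : ℝ) (a b : ℂ), (a * (r * b)).re = r * (a * b).re := fun r a b => by
    rw [mul_left_comm, Complex.re_ofReal_mul]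
  rw [e2]
  ring

/-! ### Martingale differences and summation by parts. -/

section Differences

variable {A : Type*} [AddCommGroup A]

/-- The successive differences of a sequence. -/
def successiveDiff (M : ℕ → A) : ℕ → A
  | 0 => M 0
  | n + 1 => M (n + 1) - M n

theorem sum_successiveDiff (M : ℕ → A) (n : ℕ) :
    ∑ k ∈ Finset.range (n + 1), successiveDiff M k = M n := by
  induction n with
  | zero => simp [successiveDiff]
  | succ n ih => rw [Finset.sum_range_succ, ih, successiveDiff, add_sub_cancel]

theorem pairwise_inner_successiveDiff {H : Type*} [NormedAddCommGroup H] [InnerProductSpace ℂ H]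
    {M : ℕ → H} {β : ℕ → ℂ} (hM : ∀ i j, inner ℂ (M i) (M j) = β (min i j)) :
    Pairwise fun i j => inner ℂ (successiveDiff M i) (successiveDiff M j) = 0 := by
  intro i j hij
  rcases i with _ | i <;> rcases j with _ | j
  · exact absurd rfl hij
  · simp [successiveDiff, hM]
  · simp [successiveDiff, hM]
  · simp only [successiveDiff, inner_sub_right, inner_sub_left, hM]
    rcases lt_or_gt_of_ne hij with h1 | h1
    · have e1 : min (i + 1) (j + 1) = i + 1 := by omega
      have e2 : min i (j + 1) = i := by omega
      have e3 : min (i + 1) j = i + 1 := by omega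
      have e4 : min i j = i := by omega
      rw [e1, e2, e3, e4]
      ring
    · have e1 : min (i + 1) (j + 1) = j + 1 := by omega
      have e2 : min i (j + 1) = j + 1 := by omega
      have e3 : min (i + 1) j = j := by omega
      have e4 : min i j = j := by omega
      rw [e1, e2, e3, e4]
      ring

/-- M (min i j) is the sum of the differences with k ≤ i and k ≤ j. For fixed k the double sum then
factors into a tail times its conjugate. Indices between m and n have empty tails, so all spheres of
a ball can share one range of k. -/
theorem sum_sum_min_eq (M : ℕ → ℂ) (a : ℕ → ℂ) {m n : ℕ} (hmn : m ≤ n) :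
    ∑ j ∈ Finset.range (m + 1), ∑ i ∈ Finset.range (m + 1),
        (starRingEnd ℂ) (a j) * a i * M (min i j) =
      ∑ k ∈ Finset.range (n + 1),
        ((‖∑ j ∈ Finset.range (m + 1), if k ≤ j then a j else 0‖ ^ 2 : ℝ) : ℂ) *
          successiveDiff M k := by
  have hM : ∀ i ∈ Finset.range (m + 1), ∀ j, M (min i j) = ∑ k ∈ Finset.range (n + 1),
      if k ≤ i ∧ k ≤ j then successiveDiff M k else 0 := by
    intro i hi j
    rw [← sum_successiveDiff M (min i j), ← Finset.sum_filter]
    refine Finset.sum_congr ?_ fun _ _ => rfl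
    ext k
    simp only [Finset.mem_range, Finset.mem_filter] at *
    omega
  have hsq : ∀ k, ((‖∑ j ∈ Finset.range (m + 1), if k ≤ j then a j else 0‖ ^ 2 : ℝ) : ℂ) =
      ∑ j ∈ Finset.range (m + 1), ∑ i ∈ Finset.range (m + 1),
        (if k ≤ j then (starRingEnd ℂ) (a j) else 0) * (if k ≤ i then a i else 0) := by
    intro k
    rw [Complex.ofReal_pow, ← Complex.conj_mul', map_sum, Finset.sum_mul_sum]
    refine Finset.sum_congr rfl fun j _ => Finset.sum_congr rfl fun i _ => ?_
    split_ifs <;> simp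
  simp_rw [hsq, Finset.sum_mul]
  rw [Finset.sum_comm (s := Finset.range (n + 1))]
  refine Finset.sum_congr rfl fun j _ => ?_
  rw [Finset.sum_comm (s := Finset.range (n + 1))]
  refine Finset.sum_congr rfl fun i hi => ?_
  rw [hM i hi j, Finset.mul_sum]
  refine Finset.sum_congr rfl fun k _ => ?_
  by_cases h1 : k ≤ i <;> by_cases h2 : k ≤ j <;> simp [h1, h2]

end Differences

theorem coef_conj (q : ℕ) (s : ℂ) (j : ℕ) :
    coef q ((starRingEnd ℂ) s) j = (starRingEnd ℂ) (coef q s j) := by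
  rw [coef, coef, map_div₀, Complex.conj_ofReal]
  cases j <;> simp [increment]

end HomTree

/-! ### The boundary martingale in L² and the averages of u. -/

namespace HomTree

universe v

variable {V : Type v} {G : SimpleGraph V} [G.LocallyFinite] {q : ℕ} {o : V}

theorem sum_neighbors_of_laplacian_eq (hq : 2 ≤ q) {z : ℂ} {u : V → ℂ} {x : V}
    (hx : laplacian G q u x = gammaFn q z * u x) :
    ∑ y ∈ G.neighborFinset x, u y =
      ((q : ℂ) ^ (1 / 2 + Complex.I * z) + q / (q : ℂ) ^ (1 / 2 + Complex.I * z)) * u x := by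
  have hq1 : (q : ℂ) + 1 ≠ 0 := by exact_mod_cast (by omega : q + 1 ≠ 0)
  have hs0 : (q : ℂ) ^ (1 / 2 + Complex.I * z) ≠ 0 := by
    rw [Complex.cpow_ne_zero_iff]
    left
    exact_mod_cast (by omega : q ≠ 0)
  have hst : (q : ℂ) / (q : ℂ) ^ (1 / 2 + Complex.I * z) =
      (q : ℂ) ^ (1 / 2 - Complex.I * z) := by
    rw [div_eq_iff hs0, mul_comm, natCast_cpow_mul_cpow hq]
  rw [hst]
  rw [laplacian, gammaFn] at hx
  generalize (q : ℂ) ^ (1 / 2 + Complex.I * z) = a at *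
  generalize (q : ℂ) ^ (1 / 2 - Complex.I * z) = b at *
  field_simp at hx
  linear_combination -hx

/-- On a sector of level i the first factor is constant, and the martingale property replaces the
second by its value at level i. The Gram matrix thus depends only on min(i, j), which makes the
differences orthogonal. -/
theorem integral_inner_boundaryDensity (h : IsHomogeneousTree G q) {s : ℂ} (hs0 : s ≠ 0)
    (hs1 : s ^ 2 ≠ 1) {u : V → ℂ}
    (hu : ∀ x, ∑ y ∈ G.neighborFinset x, u y = (s + q / s) * u x) {i j : ℕ} (hij : i ≤ j) :
    ∫ ω : Boundary G o, inner ℂ (boundaryDensity h.isTree.connected o q s u (ω.vertex i))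
        (boundaryDensity h.isTree.connected o q s u (ω.vertex j)) ∂(boundaryMeasure h o) =
      ((∫ ω : Boundary G o, ‖boundaryDensity h.isTree.connected o q s u (ω.vertex i)‖ ^ 2
        ∂(boundaryMeasure h o) : ℝ) : ℂ) := by
  set M := boundaryDensity h.isTree.connected o q s u with hM
  have hint : Integrable (fun ω : Boundary G o => inner ℂ (M (ω.vertex i)) (M (ω.vertex j)))
      (boundaryMeasure h o) := by
    simp only [RCLike.inner_apply]
    exact (memLp_comp_vertex h M j 2).integrable_mul
      (memLp_comp_vertex h (fun x => (starRingEnd ℂ) (M x)) i 2)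
  rw [integral_eq_sum_sphere h i hint, integral_comp_vertex h (fun x => ‖M x‖ ^ 2), smul_eq_mul,
    Finset.mul_sum, Complex.ofReal_sum]
  refine Finset.sum_congr rfl fun x hx => ?_
  obtain ⟨ω₀, hω₀⟩ := exists_ray_through (o := o) h x
  rw [mem_sphere.mp hx] at hω₀
  have h1 : ∀ ω ∈ sector G o x, inner ℂ (M (ω.vertex i)) (M (ω.vertex j)) =
      (starRingEnd ℂ) (M x) * M (ω.vertex j) := by
    intro ω hω
    rw [mem_sector_iff h.isTree.connected, mem_sphere.mp hx] at hω
    rw [hω, RCLike.inner_apply, mul_comm]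
  have h2 := setIntegral_boundaryDensity_vertex h hs0 hs1 hu ω₀ j i
  rw [min_eq_right hij, hω₀, ← hM] at h2
  rw [setIntegral_congr_fun (measurableSet_sector x) h1, integral_const_mul, h2, mul_left_comm,
    Complex.conj_mul']
  push_cast
  rfl

theorem inner_toLp_eq_integral {Ω : Type*} [MeasurableSpace Ω] {μ : Measure Ω} {f g : Ω → ℂ}
    (hf : MemLp f 2 μ) (hg : MemLp g 2 μ) :
    inner ℂ (hf.toLp f) (hg.toLp g) = ∫ ω, inner ℂ (f ω) (g ω) ∂μ := by
  rw [L2.inner_def]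
  refine integral_congr_ae ?_
  filter_upwards [hf.coeFn_toLp, hg.coeFn_toLp] with ω h1 h2
  rw [h1, h2]

theorem coeFn_successiveDiff_toLp {Ω : Type*} [MeasurableSpace Ω] {μ : Measure Ω} {p : ℝ≥0∞}
    {f : ℕ → Ω → ℂ} (hf : ∀ n, MemLp (f n) p μ) (k : ℕ) :
    (successiveDiff (fun n => (hf n).toLp (f n)) k : Lp ℂ p μ) =ᵐ[μ]
      fun ω => successiveDiff (fun n => f n ω) k := by
  cases k with
  | zero => exact (hf 0).coeFn_toLp
  | succ k =>
    simp only [successiveDiff]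
    filter_upwards [Lp.coeFn_sub ((hf (k + 1)).toLp (f (k + 1))) ((hf k).toLp (f k)),
      (hf (k + 1)).coeFn_toLp, (hf k).coeFn_toLp] with ω h1 h2 h3
    rw [h1, Pi.sub_apply, h2, h3]

theorem coeFn_sum_smul {Ω : Type*} [MeasurableSpace Ω] {μ : Measure Ω} {p : ℝ≥0∞}
    (S : Finset ℕ) (c : ℕ → ℂ) {D : ℕ → Lp ℂ p μ} {d : ℕ → Ω → ℂ} (hD : ∀ k, D k =ᵐ[μ] d k) :
    (∑ k ∈ S, c k • D k : Lp ℂ p μ) =ᵐ[μ] fun ω => ∑ k ∈ S, c k * d k ω := by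
  have h1 : ∀ᵐ ω ∂μ, ∀ k, (c k • D k : Lp ℂ p μ) ω = c k * d k ω := by
    refine ae_all_iff.mpr fun k => ?_
    filter_upwards [Lp.coeFn_smul (c k) (D k), hD k] with ω h1 h2
    rw [h1, Pi.smul_apply, h2, smul_eq_mul]
  filter_upwards [Lp.coeFn_fun_finsetSum S (fun k => c k • D k), h1] with ω h1 h2
  rw [h1]
  exact Finset.sum_congr rfl fun k _ => h2 k

/-- The averages of an eigenfunction in terms of the differences of its boundary martingale. -/
theorem normalizedAverage_eq_sum (h : IsHomogeneousTree G q) {z : ℝ} {s : ℂ}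
    (hs : s = (q : ℂ) ^ (1 / 2 + Complex.I * z)) {u : V → ℂ}
    (hu : ∀ x, ∑ y ∈ G.neighborFinset x, u y = (s + q / s) * u x) (n : ℕ) (ω : Boundary G o) :
    normalizedAverage G o q z u n ω = ∑ k ∈ Finset.range (n + 1),
      (((q : ℝ) / (2 * ((q : ℝ) + 1) * ‖cFn q z‖ ^ 2) * averageCoef q s n k : ℝ) : ℂ) *
        successiveDiff (fun n => boundaryDensity h.isTree.connected o q s u (ω.vertex n)) k := by
  have hq := h.two_le
  have hs0 : s ≠ 0 := by
    rw [hs, Complex.cpow_ne_zero_iff]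
    left
    exact_mod_cast (by omega : q ≠ 0)
  have hs1 : s ^ 2 ≠ 1 := sq_ne_one_of_norm_sq hq (by rw [hs, norm_natCast_cpow_sq hq])
  have hst : s * (q : ℂ) ^ (1 / 2 - Complex.I * z) = q := by rw [hs, natCast_cpow_mul_cpow hq]
  have hconj : (q : ℂ) ^ (1 / 2 - Complex.I * z) = (starRingEnd ℂ) s := by
    rw [hs, conj_natCast_cpow hq]
  rw [normalizedAverage, finsum_mem_ball h]
  have h1 : ∀ m ∈ Finset.range (n + 1), ∑ x ∈ sphere h o m,
      ((poissonKernel G o q x ω : ℝ) : ℂ) ^ (1 / 2 - Complex.I * z) * u x =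
      ∑ k ∈ Finset.range (n + 1),
        ((sphereCard q m / (q : ℝ) ^ m * ‖tailCoef q s m k‖ ^ 2 : ℝ) : ℂ) *
        successiveDiff (fun n => boundaryDensity h.isTree.connected o q s u (ω.vertex n)) k := by
    intro m hm
    rw [sum_sphere_poissonKernel_cpow_mul h hs0 hs1 hst hu, hconj]
    simp_rw [coef_conj]
    rw [sum_sum_min_eq (fun n => boundaryDensity h.isTree.connected o q s u (ω.vertex n))
      (coef q s) (Finset.mem_range_succ_iff.mp hm), Finset.mul_sum]
    refine Finset.sum_congr rfl fun k _ => ?_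
    rw [tailCoef, ← mul_assoc]
    push_cast
    rfl
  rw [Finset.sum_congr rfl h1, Finset.sum_comm, Finset.mul_sum, Finset.mul_sum]
  refine Finset.sum_congr rfl fun k _ => ?_
  rw [averageCoef, ← Finset.sum_mul]
  push_cast
  ring

/-- The boundary martingale of a weak `L²` eigenfunction is bounded in `L²`. -/
theorem exists_integral_sq_boundaryDensity_le (h : IsHomogeneousTree G q) {s : ℂ}
    (hs : ‖s‖ ^ 2 = q) {u : V → ℂ} (hweak : MemWeakL 2 u)
    (hmono : Monotone fun n => ∫ ω : Boundary G o,
      ‖boundaryDensity h.isTree.connected o q s u (ω.vertex n)‖ ^ 2 ∂(boundaryMeasure h o)) :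
    ∃ C, ∀ n, ∫ ω : Boundary G o,
      ‖boundaryDensity h.isTree.connected o q s u (ω.vertex n)‖ ^ 2 ∂(boundaryMeasure h o) ≤ C := by
  obtain ⟨K, hK⟩ := exists_sum_sphere_sq_le h o hweak
  have hs1 := sq_ne_one_of_norm_sq h.two_le hs
  set c : ℝ := 8 * q ^ 2 / ‖s ^ 2 - 1‖ ^ 2 with hc
  have hc0 : 0 ≤ c := by positivity
  set S : ℕ → ℝ := fun m => ∑ x ∈ sphere h o m, ‖u x‖ ^ 2 with hS
  have hS0 : ∀ m, 0 ≤ S m := fun m => Finset.sum_nonneg fun _ _ => by positivity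
  refine ⟨_, le_of_monotone_of_sum_le (K := c * (2 * K)) hmono ?_
    (integral_nonneg fun _ => by positivity)⟩
  intro n
  refine (Finset.sum_le_sum fun m _ => integral_sq_boundaryDensity_le h hs hs1 u m).trans ?_
  rw [← Finset.mul_sum, Finset.sum_add_distrib, mul_assoc]
  refine mul_le_mul_of_nonneg_left ?_ hc0
  have h1 := hK (n + 1)
  have h2 : ∑ m ∈ Finset.range (n + 1), S (m + 1) ≤ ∑ m ∈ Finset.range (n + 1 + 1), S m := by
    rw [Finset.sum_range_succ' _ (n + 1)]
    have := hS0 0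
    linarith
  have h3 : ∑ m ∈ Finset.range (n + 1), S m ≤ ∑ m ∈ Finset.range (n + 1 + 1), S m := by
    rw [Finset.sum_range_succ _ (n + 1)]
    have := hS0 (n + 1)
    linarith
  push_cast at h1
  have h4 : K * ((n : ℝ) + 1 + 2) = K * (n + 3) := by ring
  linarith

end HomTree

/-! ### The theorem: existence of F, the inversion formula and uniqueness. -/

open HomTree in
theorem mainTheorem6 {V : Type*} (G : SimpleGraph V) [G.LocallyFinite] (q : ℕ)
    (h : HomTree.IsHomogeneousTree G q) (o : V)
    (z : ℝ) (hz : ∀ k : ℤ, z ≠ (k : ℝ) * (HomTree.tau q / 2))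
    (u : V → ℂ) (hu : HomTree.MemWeakL 2 u)
    (heig : ∀ x, HomTree.laplacian G q u x = HomTree.gammaFn q z * u x) :
    ∃ F : Lp ℂ 2 (HomTree.boundaryMeasure h o),
      ((∀ x, u x = HomTree.poissonTransform h o z F x) ∧
        ∀ H : Lp ℂ 2 (HomTree.boundaryMeasure h o),
          (∀ x, u x = HomTree.poissonTransform h o z H x) → H = F) ∧
      ((∀ n, MemLp (HomTree.normalizedAverage G o q z u n) 2 (HomTree.boundaryMeasure h o)) ∧
        Tendsto (fun n : ℕ => eLpNorm (fun ω => HomTree.normalizedAverage G o q z u n ω - F ω) 2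
          (HomTree.boundaryMeasure h o)) atTop (𝓝 0) ∧
        ∀ H : Lp ℂ 2 (HomTree.boundaryMeasure h o),
          Tendsto (fun n : ℕ => eLpNorm (fun ω => HomTree.normalizedAverage G o q z u n ω - H ω) 2
            (HomTree.boundaryMeasure h o)) atTop (𝓝 0) → H = F) := by
  have hq := h.two_le
  have hG := h.isTree.connected
  have hq0 : (0 : ℝ) < q := by exact_mod_cast (by omega : 0 < q)
  set s : ℂ := (q : ℂ) ^ (1 / 2 + Complex.I * z) with hs
  have hs0 : s ≠ 0 := by
    rw [hs, Complex.cpow_ne_zero_iff]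
    left
    exact_mod_cast (by omega : q ≠ 0)
  have hsn : ‖s‖ ^ 2 = q := norm_natCast_cpow_sq hq z
  have hs1 : s ^ 2 ≠ 1 := sq_ne_one_of_norm_sq hq hsn
  have hw : s ^ 2 / q ≠ 1 := natCast_cpow_sq_div_ne_one hq hz
  have heig' : ∀ x, ∑ y ∈ G.neighborFinset x, u y = (s + q / s) * u x :=
    fun x => sum_neighbors_of_laplacian_eq hq (heig x)
  set M : V → ℂ := boundaryDensity hG o q s u with hM
  have hmem : ∀ n, MemLp (fun ω : Boundary G o => M (ω.vertex n)) 2 (boundaryMeasure h o) :=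
    fun n => memLp_comp_vertex h M n 2
  set Mseq : ℕ → Lp ℂ 2 (boundaryMeasure h o) := fun n => (hmem n).toLp _ with hMseq
  set b : ℕ → ℝ := fun n => ∫ ω : Boundary G o, ‖M (ω.vertex n)‖ ^ 2 ∂(boundaryMeasure h o)
    with hb
  have hinner : ∀ i j, inner ℂ (Mseq i) (Mseq j) = (b (min i j) : ℂ) := by
    have hle : ∀ i j, i ≤ j → inner ℂ (Mseq i) (Mseq j) = (b i : ℂ) := fun i j hij => by
      rw [hMseq, inner_toLp_eq_integral, integral_inner_boundaryDensity h hs0 hs1 heig' hij]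
    intro i j
    rcases le_total i j with hij | hij
    · rw [min_eq_left hij, hle i j hij]
    · rw [min_eq_right hij, ← inner_conj_symm, hle j i hij, Complex.conj_ofReal]
  have horth := pairwise_inner_successiveDiff (β := fun n => (b n : ℂ)) hinner
  have hbsum : ∀ n, ∑ k ∈ Finset.range (n + 1), ‖successiveDiff Mseq k‖ ^ 2 = b n := by
    intro n
    have h1 := norm_sum_smul_sq horth (fun _ => 1) (Finset.range (n + 1))
    simp only [one_smul, norm_one, one_pow, one_mul] at h1
    rw [← h1, sum_successiveDiff, ← Complex.ofReal_inj, ← min_self n, ← hinner,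
      inner_self_eq_norm_sq_to_K]
    simp
  have hmono : Monotone b := by
    refine monotone_nat_of_le_succ fun n => ?_
    rw [← hbsum, ← hbsum, Finset.sum_range_succ _ (n + 1)]
    have : 0 ≤ ‖successiveDiff Mseq (n + 1)‖ ^ 2 := by positivity
    linarith
  obtain ⟨C, hC⟩ := exists_integral_sq_boundaryDensity_le h hsn hu hmono
  obtain ⟨F, hF, hlim⟩ := tendsto_sum_of_pairwise_orthogonal horth
    fun n => (hbsum n).le.trans (hC n)
  simp_rw [sum_successiveDiff] at hF
  have hFint : ∀ H : Lp ℂ 2 (boundaryMeasure h o), Integrable H (boundaryMeasure h o) :=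
    fun H => (Lp.memLp H).integrable (by norm_num)
  -- Pairing with the indicator of E(x) is continuous on L², and along the martingale it is constant
  -- once n ≥ |x|.
  have hmass : ∀ x, ∫ ω in sector G o x, F ω ∂(boundaryMeasure h o) =
      boundaryMass hG o s u x := by
    intro x
    have h1 := (tendsto_const_nhds
      (x := indicatorConstLp 2 (measurableSet_sector x) (measure_ne_top (boundaryMeasure h o) _)
        (1 : ℂ))).inner (𝕜 := ℂ) hF
    simp_rw [L2.inner_indicatorConstLp_one] at h1
    refine tendsto_nhds_unique h1 (tendsto_const_nhds.congr' ?_)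
    filter_upwards [eventually_ge_atTop (G.dist o x)] with n hn
    obtain ⟨r, rfl⟩ := Nat.exists_eq_add_of_le hn
    rw [← setIntegral_boundaryDensity h hs0 hs1 heig' r x]
    exact integral_congr_ae (ae_restrict_of_ae (hmem _).coeFn_toLp.symm)
  have hu_eq : ∀ x, u x = poissonTransform h o z F x := by
    intro x
    obtain ⟨ω, hω⟩ := exists_ray_through (o := o) h x
    have h1 := poissonTransform_mul h z (hFint F) ω (G.dist o x)
    simp_rw [hmass] at h1
    rw [sum_increment_mul_boundaryMass h.isTree hs0 hs1, hω] at h1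
    exact (mul_left_cancel₀ (pow_ne_zero _ hs0) h1).symm
  have hB : ‖cFn q z‖ ^ 2 = ‖(s ^ 2 - 1) / (q + 1) / (s ^ 2 / q - 1)‖ ^ 2 := by
    rw [cFn_eq hq hw]
  have hB0 : ‖cFn q z‖ ^ 2 ≠ 0 := by
    rw [hB]
    have hq1 : (q : ℂ) + 1 ≠ 0 := by exact_mod_cast (by omega : q + 1 ≠ 0)
    exact pow_ne_zero _ (norm_ne_zero_iff.mpr (div_ne_zero (div_ne_zero (sub_ne_zero.mpr hs1) hq1)
      (sub_ne_zero.mpr hw)))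
  set c : ℝ := (q : ℝ) / (2 * ((q : ℝ) + 1) * ‖cFn q z‖ ^ 2) with hc
  have hae : ∀ n, (∑ k ∈ Finset.range (n + 1), ((c * averageCoef q s n k : ℝ) : ℂ) •
      successiveDiff Mseq k : Lp ℂ 2 (boundaryMeasure h o)) =ᵐ[boundaryMeasure h o]
        normalizedAverage G o q z u n := by
    intro n
    refine (coeFn_sum_smul _ _ (coeFn_successiveDiff_toLp hmem)).trans ?_
    exact Eventually.of_forall fun ω => (normalizedAverage_eq_sum h hs heig' n ω).symm
  have hmemA : ∀ n, MemLp (normalizedAverage G o q z u n) 2 (boundaryMeasure h o) :=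
    fun n => (memLp_congr_ae (hae n)).mp (Lp.memLp _)
  have hlimF : Tendsto (fun n => (hmemA n).toLp _) atTop (𝓝 F) := by
    -- The normalizing constant is the inverse of the common limit of the multipliers, hence κ = 1.
    have h1 := hlim (lam := fun n k => c * averageCoef q s n k) (κ := 1)
      (B := |c| * (16 * ‖(s ^ 2 - 1) / (q + 1) / (s ^ 2 / q - 1)‖ ^ 2))
      (fun n k => by
        rw [abs_mul]
        gcongr
        exact abs_averageCoef_le hq hsn hw n k)
      (fun k => by
        have h2 := (tendsto_averageCoef hq hsn hw k).const_mul c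
        have h3 : c * (2 * ((q : ℝ) + 1) * ‖(s ^ 2 - 1) / (q + 1) / (s ^ 2 / q - 1)‖ ^ 2 / q)
            = 1 := by
          rw [hc, ← hB]
          generalize ‖cFn q z‖ ^ 2 = a at *
          field_simp
        rwa [h3] at h2)
    rw [Complex.ofReal_one, one_smul] at h1
    refine h1.congr fun n => ?_
    exact Lp.ext ((hae n).trans (hmemA n).coeFn_toLp.symm)
  have hiff : ∀ H : Lp ℂ 2 (boundaryMeasure h o),
      Tendsto (fun n => eLpNorm (fun ω => normalizedAverage G o q z u n ω - H ω) 2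
        (boundaryMeasure h o)) atTop (𝓝 0) ↔
      Tendsto (fun n => (hmemA n).toLp _) atTop (𝓝 H) := by
    intro H
    have h1 := Lp.tendsto_Lp_iff_tendsto_eLpNorm'' (fi := atTop) _ hmemA H (Lp.memLp H)
    rw [Lp.toLp_coeFn] at h1
    exact h1.symm
  refine ⟨F, ⟨hu_eq, fun H hH => ?_⟩, hmemA, (hiff F).mpr hlimF,
    fun H hH => tendsto_nhds_unique ((hiff H).mp hH) hlimF⟩
  have hHF : ∀ x, ∫ ω in sector G o x, H ω ∂(boundaryMeasure h o) =
      ∫ ω in sector G o x, F ω ∂(boundaryMeasure h o) := by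
    refine eq_of_sum_increment_mul_eq (o := o) h hs0 hs1 fun ω m => ?_
    rw [← poissonTransform_mul h z (hFint H), ← poissonTransform_mul h z (hFint F), ← hH,
      ← hu_eq]
  have h0 := ae_eq_zero_of_setIntegral_sector h ((hFint H).sub (hFint F)) fun x => by
    simp only [Pi.sub_apply]
    rw [integral_sub (hFint H).integrableOn (hFint F).integrableOn, hHF, sub_self]
  refine Lp.ext ?_
  filter_upwards [h0] with ω hω
  exact sub_eq_zero.mp hω
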